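/- Let $T>0$, let $\mu$ be the Wiener measure on $W=C([0,T])$, i.e. the law under which $B_t(\omega)=\omega(t)$ is a centered Gaussian process with covariance $\min(s,t)$, and let $\delta(f)=\int_0^T f(s)\,dB_s$ be the Wiener integral of $f\in L^2([0,T])$. Put $\mathcal E(f)=\exp\{\delta(f)-\tfrac12|f|^2\}$, where $|\cdot|$ is the norm of $L^2([0,T])$; let $(T_gX)(\omega)=X\big(\omega+\int_0^{\cdot}g(s)\,ds\big)$ for $g\in L^2([0,T])$; and write $SX(f)=E[X\,\mathcal E(f)]$. For random variables $X,Y,Z$, each in $\mathcal L^{r}(W,\mu)$ for some $r>1$, the relation $Z=X\diamond Y$ (Wick product) means $SZ(f)=SX(f)\,SY(f)$ for all $f\in L^2([0,T])$; this determines $Z$ almost surely and gives $\mathcal E(f)\diamond\mathcal E(g)=\mathcal E(f+g)$. Let $\mathbb D^{1,p}$ be the Malliavin–Sobolev space, i.e. the closure of the linear span of the $\mathcal E(f)$ in the norm $\|X\|_p+\|\,|DX|\,\|_p$, where $D\mathcal E(f)=\mathcal E(f)f$. Let $1<p<\infty$, let $t\mapsto X_t$ be differentiable from $[0,T]$ to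 $\mathcal L^p(W,\mu)$, and let $t\mapsto h(t,\cdot)$ be differentiable (in particular, this covers $C^1$) from $[0,T]$ to $L^2([0,T])$, with derivative $\partial_t h(t,\cdot)$; derivatives at the end points are one-sided. If $h(t,\cdot)$ is given by a function on $[0,T]^2$ that is, for almost every $s$, continuously differentiable in $t$, then $\partial_th(t,\cdot)$ is, for every $t$, almost everywhere its pointwise partial derivative. For every $t\in[0,T]$ the formula $$\frac{d}{dt}\big(T_{h(t,\cdot)}X_t\big)=T_{h(t,\cdot)}\frac{dX_t}{dt}+T_{h(t,\cdot)}X_t\cdot\delta(\partial_th(t,\cdot))-T_{h(t,\cdot)}X_t\diamond\delta(\partial_th(t,\cdot))$$ holds in the following senses. 1. The random variables $T_{h(t,\cdot)}X_t$, $T_{h(t,\cdot)}\frac{dX_t}{dt}$ and $T_{h(t,\cdot)}X_t\cdot\delta(\partial_th(t,\cdot))$ are in $\mathcal L^q(W,\mu)$ for all $q<p$, and the formula always holds for generalized random variables: for every $f\in L^2([0,T])$ the function $t\mapsto S(T_{h(t,\cdot)}X_t)(f)$ is differentiable, with derivative $$S\Big(T_{h(t,\cdot)}\frac{dX_t}{dt}\Big)(f)+S\big(T_{h(t,\cdot)}X_t\cdot\delta(\partial_th(t,\cdot))\big)(f)-S\big(T_{h(t,\cdot)}X_t\big)(f)\,S\big(\delta(\partial_th(t,\cdot))\big)(f).$$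 2. If $t\mapsto T_{h(t,\cdot)}X_t$ is differentiable at $t$ in the norm of $\mathcal L^q(W,\mu)$ for some $q>1$, then the Wick product $T_{h(t,\cdot)}X_t\diamond\delta(\partial_th(t,\cdot))$ exists as a random variable and the formula holds almost surely. 3. If $X_t\in\mathbb D^{1,p}$ at the given $t$, then the Wick product $T_{h(t,\cdot)}X_t\diamond\delta(\partial_th(t,\cdot))$ exists and is in $\mathcal L^q(W,\mu)$, the map $u\mapsto T_{h(u,\cdot)}X_u$ is differentiable at $t$ in the norm of $\mathcal L^q(W,\mu)$, and the formula holds there, for all $1\le q<p$. -/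

import Mathlib

open MeasureTheory ProbabilityTheory Filter Topology Set
open scoped ENNReal NNReal

noncomputable section

/-- The path space of real-valued continuous functions on `[0,T]`. -/
abbrev PathSpace (T : ℝ) : Type := C(Set.Icc (0 : ℝ) T, ℝ)

instance (T : ℝ) : MeasurableSpace (PathSpace T) := borel _

instance (T : ℝ) : BorelSpace (PathSpace T) := ⟨rfl⟩

/-- `μ` is the Wiener measure on `C([0,T])`: under `μ` the coordinate process `B_t(ω) = ω(t)` is a
centered Gaussian process with covariance `min s t`. (In particular `ω(0) = 0` almost surely.) -/
structure IsWienerMeasure (T : ℝ) (μ : Measure (PathSpace T)) : Prop where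
  isGaussianProcess : IsGaussianProcess (fun (t : Set.Icc (0 : ℝ) T) (ω : PathSpace T) => ω t) μ
  integral_eval : ∀ t : Set.Icc (0 : ℝ) T, ∫ ω, ω t ∂μ = 0
  integral_mul : ∀ s t : Set.Icc (0 : ℝ) T, ∫ ω, ω s * ω t ∂μ = min (s : ℝ) (t : ℝ)

/-- The Hilbert space `L²([0,T])`. -/
abbrev L2T (T : ℝ) : Type := Lp ℝ 2 (volume.restrict (Set.Icc (0 : ℝ) T))

variable {T : ℝ} {μ : Measure (PathSpace T)}

theorem IsWienerMeasure.isProbabilityMeasure (hμ : IsWienerMeasure T μ) :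
    IsProbabilityMeasure μ := hμ.isGaussianProcess.isProbabilityMeasure

theorem IsWienerMeasure.memLp_eval (hμ : IsWienerMeasure T μ) (t : Set.Icc (0 : ℝ) T) :
    MemLp (fun ω : PathSpace T => ω t) 2 μ :=
  (hμ.isGaussianProcess.hasGaussianLaw_eval t).memLp_two

/-! ### The Wiener integral -/

/-- The indicator function `1_{(0,s]}` in `L²([0,T])`. -/
def indLp (s : Set.Icc (0 : ℝ) T) : L2T T :=
  indicatorConstLp 2 (measurableSet_Ioc (a := (0 : ℝ)) (b := (s : ℝ))) (measure_ne_top _ _) (1 : ℝ)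

/-- The step function `∑ c_s 1_{(0,s]}`. -/
def stepMap (T : ℝ) : (Set.Icc (0 : ℝ) T →₀ ℝ) →ₗ[ℝ] L2T T :=
  Finsupp.linearCombination ℝ (indLp (T := T))

/-- The random variable `∑ c_s B_s`. -/
def stepIntegral (hμ : IsWienerMeasure T μ) : (Set.Icc (0 : ℝ) T →₀ ℝ) →ₗ[ℝ] Lp ℝ 2 μ :=
  Finsupp.linearCombination ℝ (fun s => (hμ.memLp_eval s).toLp)

/-- The Wiener integral `δ(f) = ∫₀ᵀ f(s) dB_s`: the continuous linear extension to `L²([0,T])` of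
the map `∑ c_s 1_{(0,s]} ↦ ∑ c_s B_s` (which is isometric and densely defined). -/
def wienerIntegral (hμ : IsWienerMeasure T μ) : L2T T →L[ℝ] Lp ℝ 2 μ :=
  (stepIntegral hμ).extendOfNorm (stepMap T)

/-! The step integral is isometric and densely defined, so its extension is the Wiener integral. -/

theorem inner_indLp (s t : Set.Icc (0 : ℝ) T) :
    inner ℝ (indLp s) (indLp t) = min (s : ℝ) (t : ℝ) := by
  have hs := s.2
  have ht := t.2
  rw [indLp, indLp, L2.inner_indicatorConstLp_one, setIntegral_indicatorConstLp measurableSet_Ioc,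
    measureReal_restrict_apply (measurableSet_Ioc.inter measurableSet_Ioc),
    Set.Ioc_inter_Ioc]
  have : Set.Ioc (max (0:ℝ) 0) (min (t:ℝ) s) ∩ Set.Icc 0 T = Set.Ioc (0:ℝ) (min (s:ℝ) t) := by
    ext x
    simp only [Set.mem_inter_iff, Set.mem_Ioc, Set.mem_Icc, le_min_iff, max_self]
    constructor
    · rintro ⟨⟨h1, h2, h3⟩, -⟩; exact ⟨h1, h3, h2⟩
    · rintro ⟨h1, h2, h3⟩; exact ⟨⟨h1, h3, h2⟩, h1.le, h3.trans ht.2⟩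
  rw [this]
  rw [Measure.real, Real.volume_Ioc, sub_zero, ENNReal.toReal_ofReal (le_min hs.1 ht.1),
    smul_eq_mul, mul_one]

theorem IsWienerMeasure.inner_eval (hμ : IsWienerMeasure T μ) (s t : Set.Icc (0 : ℝ) T) :
    inner ℝ (hμ.memLp_eval s).toLp (hμ.memLp_eval t).toLp = min (s : ℝ) (t : ℝ) := by
  rw [L2.inner_def, ← hμ.integral_mul s t]
  refine integral_congr_ae ?_
  filter_upwards [(hμ.memLp_eval s).coeFn_toLp, (hμ.memLp_eval t).coeFn_toLp] with ω h1 h2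
  simp [h1, h2, mul_comm]

theorem norm_stepIntegral (hμ : IsWienerMeasure T μ) (c : Set.Icc (0 : ℝ) T →₀ ℝ) :
    ‖stepIntegral hμ c‖ = ‖stepMap T c‖ := by
  have key : inner ℝ (stepIntegral hμ c) (stepIntegral hμ c)
      = inner ℝ (stepMap T c) (stepMap T c) := by
    simp only [stepIntegral, stepMap, Finsupp.linearCombination_apply, Finsupp.sum, sum_inner,
      inner_sum, inner_smul_left, inner_smul_right, hμ.inner_eval, inner_indLp]
  rw [real_inner_self_eq_norm_sq, real_inner_self_eq_norm_sq] at key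
  exact (sq_eq_sq₀ (norm_nonneg _) (norm_nonneg _)).1 key

theorem denseRange_stepMap (T : ℝ) : DenseRange (stepMap T) := by
  have h : (LinearMap.range (stepMap T)).topologicalClosure = ⊤ := by
    rw [Submodule.topologicalClosure_eq_top_iff, Submodule.eq_bot_iff]
    intro g hg
    rw [Submodule.mem_orthogonal] at hg
    have hgi : Integrable g (volume.restrict (Set.Icc 0 T)) := (Lp.memLp g).integrable (by norm_num)
    have hI : ∀ s : Set.Icc (0 : ℝ) T, ∫ x in Set.Ioc 0 (s : ℝ), g x
        ∂(volume.restrict (Set.Icc 0 T)) = 0 := by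
      intro s
      have := hg (indLp s) ⟨Finsupp.single s 1, by simp [stepMap]⟩
      rwa [indLp, L2.inner_indicatorConstLp_one] at this
    have hall : ∀ A : Set ℝ, MeasurableSet A →
        ∫ x in A, g x ∂(volume.restrict (Set.Icc 0 T)) = 0 := by
      have hIic : ∀ a : ℝ, ∫ x in Set.Iic a, g x ∂(volume.restrict (Set.Icc 0 T)) = 0 := by
        intro a
        rw [Measure.restrict_restrict measurableSet_Iic]
        by_cases ha : a < 0
        · have : Set.Iic a ∩ Set.Icc 0 T = ∅ := by
            ext x; simp only [Set.mem_inter_iff, Set.mem_Iic, Set.mem_Icc, Set.mem_empty_iff_false]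
            constructor
            · rintro ⟨h1, h2, -⟩; linarith
            · exact False.elim
          simp [this]
        by_cases hT : T < 0
        · simp [Set.Icc_eq_empty (not_le.2 hT)]
        push Not at ha hT
        have hs : min a T ∈ Set.Icc 0 T := ⟨le_min ha hT, min_le_right _ _⟩
        have h2 := hI ⟨min a T, hs⟩
        rw [Measure.restrict_restrict measurableSet_Ioc] at h2
        have e1 : Set.Ioc 0 (min a T) ∩ Set.Icc 0 T = Set.Ioc 0 (min a T) := by
          refine Set.inter_eq_left.2 fun x hx => ⟨hx.1.le, hx.2.trans (min_le_right _ _)⟩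
        have e2 : Set.Iic a ∩ Set.Icc 0 T = Set.Icc 0 (min a T) := by
          ext x
          simp only [Set.mem_inter_iff, Set.mem_Iic, Set.mem_Icc, le_min_iff]
          tauto
        rw [e1] at h2
        rw [e2, integral_Icc_eq_integral_Ioc]
        exact h2
      intro A hA
      induction A, hA using MeasurableSpace.induction_on_inter
        (borel_eq_generateFrom_Iic ℝ ▸ (BorelSpace.measurable_eq (α := ℝ))) isPiSystem_Iic with
      | empty => simp
      | basic A hA =>
        obtain ⟨a, rfl⟩ := hA
        exact hIic a
      | compl A hA ih =>
        have h1 := integral_add_compl hA hgi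
        have h2 : ∫ x, g x ∂(volume.restrict (Set.Icc 0 T)) = 0 := by
          have h3 := hIic T
          rw [Measure.restrict_restrict measurableSet_Iic] at h3
          have : Set.Iic T ∩ Set.Icc 0 T = Set.Icc 0 T :=
            Set.inter_eq_right.2 fun x hx => hx.2
          rwa [this] at h3
        linarith
      | iUnion f hd hf ih =>
        rw [integral_iUnion hf hd hgi.integrableOn]
        simp [ih]
    have h0 := hgi.ae_eq_zero_of_forall_setIntegral_eq_zero (fun A hA _ => hall A hA)
    exact Lp.eq_zero_iff_ae_eq_zero.2 h0
  rw [DenseRange, dense_iff_closure_eq]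
  have := congrArg (fun S : Submodule ℝ (L2T T) => (S : Set (L2T T))) h
  rw [Submodule.topologicalClosure_coe, LinearMap.coe_range] at this
  exact this

theorem wienerIntegral_indLp (hμ : IsWienerMeasure T μ) (s : Set.Icc (0 : ℝ) T) :
    wienerIntegral hμ (indLp s) = (hμ.memLp_eval s).toLp := by
  have h := LinearMap.extendOfNorm_eq (denseRange_stepMap T) (f := stepIntegral hμ)
    ⟨1, fun c => by rw [norm_stepIntegral, one_mul]⟩ (Finsupp.single s 1)
  have e1 : stepMap T (Finsupp.single s 1) = indLp s := by simp [stepMap]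
  have e2 : stepIntegral hμ (Finsupp.single s 1) = (hμ.memLp_eval s).toLp := by
    simp [stepIntegral]
  rw [e1, e2] at h
  exact h

/-- The stochastic exponential `𝓔(f) = exp(δ(f) - |f|²/2)`. -/
def stochExp (hμ : IsWienerMeasure T μ) (f : L2T T) : PathSpace T → ℝ :=
  fun ω => Real.exp (wienerIntegral hμ f ω - ‖f‖ ^ 2 / 2)

/-! ### The translation operator -/

/-- The path `t ↦ ∫₀ᵗ g(s) ds`. -/
def primitivePath (g : L2T T) : PathSpace T where
  toFun t := ∫ s in (0 : ℝ)..(t : ℝ), g s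
  continuous_toFun := by
    by_cases hT : 0 ≤ T
    · have hg : IntegrableOn (fun s => g s) (Set.uIcc 0 T) volume := by
        rw [Set.uIcc_of_le hT]
        exact (Lp.memLp g).integrable (by norm_num)
      have := intervalIntegral.continuousOn_primitive_interval hg
      rw [Set.uIcc_of_le hT] at this
      exact continuousOn_iff_continuous_domRestrict.1 this
    · have : IsEmpty (Set.Icc (0 : ℝ) T) := by
        rw [Set.Icc_eq_empty hT]; infer_instance
      exact continuous_of_const fun x => this.elim x

/-- The translation operator `(T_g X)(ω) = X(ω + ∫₀^· g(s) ds)`. -/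
def pathShift (g : L2T T) (X : PathSpace T → ℝ) : PathSpace T → ℝ :=
  fun ω => X (ω + primitivePath g)

/-! ### The Wick product -/

/-- The S-transform `f ↦ E[X 𝓔(f)]`. -/
def sTransform (hμ : IsWienerMeasure T μ) (X : PathSpace T → ℝ) (f : L2T T) : ℝ :=
  ∫ ω, X ω * stochExp hμ f ω ∂μ

/-- `X` is a random variable in `𝓛^r` for some `r > 1`. -/
def MemLpGtOne (μ : Measure (PathSpace T)) (X : PathSpace T → ℝ) : Prop :=
  ∃ r : ℝ≥0∞, 1 < r ∧ MemLp X r μ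

/-- `Z = X ⋄ Y`. The Wick product is the (unbounded, partially defined) bilinear operation
that extends `𝓔(f) ⋄ 𝓔(g) = 𝓔(f + g)`; it is characterised by
`E[(X ⋄ Y) 𝓔(f)] = E[X 𝓔(f)] E[Y 𝓔(f)]` for all `f ∈ L²([0,T])`, and this determines `Z` almost
surely because the stochastic exponentials are total. -/
structure IsWickProduct (hμ : IsWienerMeasure T μ) (X Y Z : PathSpace T → ℝ) : Prop where
  left_mem : MemLpGtOne μ X
  right_mem : MemLpGtOne μ Y
  mem : MemLpGtOne μ Z
  sTransform_eq : ∀ f : L2T T, sTransform hμ Z f = sTransform hμ X f * sTransform hμ Y f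

/-! ### The Malliavin-Sobolev space `𝔻^{1,p}` -/

/-- The linear combination `∑ a_f 𝓔(f)` of stochastic exponentials. -/
def expComb (hμ : IsWienerMeasure T μ) (c : L2T T →₀ ℝ) : PathSpace T → ℝ :=
  fun ω => c.sum fun f a => a * stochExp hμ f ω

/-- The Malliavin derivative `∑ a_f 𝓔(f) f` of `∑ a_f 𝓔(f)`, with values in `L²([0,T])`. -/
def expCombDeriv (hμ : IsWienerMeasure T μ) (c : L2T T →₀ ℝ) : PathSpace T → L2T T :=
  fun ω => c.sum fun f a => (a * stochExp hμ f ω) • f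

/-- `X ∈ 𝔻^{1,p}`: the closure of the span of the stochastic exponentials with respect to the norm
`‖X‖_p + ‖|DX|‖_p`. -/
def MemD1 (hμ : IsWienerMeasure T μ) (p : ℝ≥0∞) (X : PathSpace T → ℝ) : Prop :=
  MemLp X p μ ∧ ∃ (DX : PathSpace T → L2T T) (c : ℕ → L2T T →₀ ℝ), MemLp DX p μ ∧
    Tendsto (fun n => eLpNorm (fun ω => expComb hμ (c n) ω - X ω) p μ) atTop (𝓝 0) ∧
    Tendsto (fun n => eLpNorm (fun ω => expCombDeriv hμ (c n) ω - DX ω) p μ) atTop (𝓝 0)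

/-! ### Differentiation in `𝓛^q` -/

/-- The process `Y` is differentiable at `t` (within `s`) in the norm of `𝓛^q(W,μ)`, with
derivative `A`. -/
def HasLqDerivWithinAt (μ : Measure (PathSpace T)) (q : ℝ≥0∞) (Y : ℝ → PathSpace T → ℝ)
    (A : PathSpace T → ℝ) (s : Set ℝ) (t : ℝ) : Prop :=
  MemLp A q μ ∧
    Tendsto (fun u => eLpNorm (fun ω => (u - t)⁻¹ * (Y u ω - Y t ω) - A ω) q μ)
      (𝓝[s \ {t}] t) (𝓝 0)

end

noncomputable section

variable {T : ℝ} {μ : Measure (PathSpace T)}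

/-! ### Gaussian laws -/

namespace IsWienerMeasure

/-! The S-transform turns translation of a random variable into translation of its argument: `S(T_g
X)(f) = SX(f + g) = E[X 𝓔(f + g)]` (`sTransform_comp_shift`, from the Cameron-Martin theorem
`map_shift`). Hence `S(T_{h(t)} X_t)(f)` is the Hölder pairing of `X_t` with `𝓔(f + h(t))`. The map
`K ↦ 𝓔(K)` is Fréchet differentiable from `L²([0,T])` into every `L^r`, `1 ≤ r < ∞`, with derivative
`v ↦ 𝓔(K)(δ(v) - ⟨K, v⟩)` (`hasFDerivAt_stochExpLp`), so the product rule applies. With `K = f +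
h(t)` and `v = h'(t)`, the part `δ(h') - ⟨h, h'⟩` yields the ordinary product with `δ(h')`, because
`T_h δ(h') = δ(h') + ⟨h', h⟩`. The remaining `-⟨f, h'⟩` is `-Sδ(h')(f)`, which is the Wick term
(`hasDerivWithinAt_sTransform`).

A derivative in `L^q`, `q > 1`, is also a derivative under every S-transform. Solving the formula
for the Wick term therefore produces a random variable with the required S-transform
(`isWickProduct_of_hasLqDerivWithinAt`).

For `X_t ∈ 𝔻^{1,p}` the derivative exists in norm. On exponentials, `T_g 𝓔(f) = exp⟨f, g⟩ 𝓔(f)`, so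
translating a linear combination along a segment gives a smooth curve, and the mean value inequality
bounds its first order remainder by the oscillation of `T_g DX` along the segment. The translations
are bounded from `L^p` to `L^q`, uniformly on balls (`eLpNorm_comp_shift_le`), which carries the
bound to the closure. Their strong continuity (`tendsto_eLpNorm_comp_shift`) then makes the
remainder `o(|v|)`. -/

theorem wienerIntegral_stepMap (hμ : IsWienerMeasure T μ) (c : Set.Icc (0 : ℝ) T →₀ ℝ) :
    wienerIntegral hμ (stepMap T c) = stepIntegral hμ c :=
  LinearMap.extendOfNorm_eq (denseRange_stepMap T) (f := stepIntegral hμ)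
    ⟨1, fun c => by rw [norm_stepIntegral, one_mul]⟩ c

theorem norm_wienerIntegral (hμ : IsWienerMeasure T μ) (f : L2T T) :
    ‖wienerIntegral hμ f‖ = ‖f‖ := by
  refine (denseRange_stepMap T).induction_on (p := fun f => ‖wienerIntegral hμ f‖ = ‖f‖) f
    (isClosed_eq (by fun_prop) (by fun_prop)) fun c => ?_
  rw [hμ.wienerIntegral_stepMap, norm_stepIntegral]

theorem wienerIntegral_add (hμ : IsWienerMeasure T μ) (f g : L2T T) :
    ∀ᵐ ω ∂μ, wienerIntegral hμ (f + g) ω = wienerIntegral hμ f ω + wienerIntegral hμ g ω := by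
  rw [map_add]
  exact Lp.coeFn_add _ _

theorem wienerIntegral_smul (hμ : IsWienerMeasure T μ) (a : ℝ) (f : L2T T) :
    ∀ᵐ ω ∂μ, wienerIntegral hμ (a • f) ω = a * wienerIntegral hμ f ω := by
  rw [map_smul]
  exact Lp.coeFn_smul _ _

theorem stronglyMeasurable_wienerIntegral (hμ : IsWienerMeasure T μ) (f : L2T T) :
    StronglyMeasurable (wienerIntegral hμ f) := Lp.stronglyMeasurable _

theorem measurable_wienerIntegral (hμ : IsWienerMeasure T μ) (f : L2T T) :
    Measurable (wienerIntegral hμ f) := (hμ.stronglyMeasurable_wienerIntegral f).measurable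

theorem stepIntegral_ae_eq (hμ : IsWienerMeasure T μ) (c : Set.Icc (0 : ℝ) T →₀ ℝ) :
    ∀ᵐ ω ∂μ, stepIntegral hμ c ω = ∑ s ∈ c.support, c s * ω s := by
  have h1 : stepIntegral hμ c = ∑ s ∈ c.support, c s • (hμ.memLp_eval s).toLp := by
    simp [stepIntegral, Finsupp.linearCombination_apply, Finsupp.sum]
  rw [h1]
  have h2 : ∀ᵐ ω ∂μ, ∀ s ∈ c.support,
      (c s • (hμ.memLp_eval s).toLp : Lp ℝ 2 μ) ω = c s * ω s := by
    refine (Filter.eventually_all_finset _).2 ?_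
    intro s _
    filter_upwards [Lp.coeFn_smul (c s) (hμ.memLp_eval s).toLp, (hμ.memLp_eval s).coeFn_toLp]
      with ω h3 h4
    simp [h3, h4]
  filter_upwards [h2, Lp.coeFn_finsetSum c.support fun s => c s • (hμ.memLp_eval s).toLp]
    with ω h3 h4
  rw [h4, Finset.sum_apply]
  exact Finset.sum_congr rfl h3

theorem hasGaussianLaw_stepIntegral (hμ : IsWienerMeasure T μ) (c : Set.Icc (0 : ℝ) T →₀ ℝ) :
    HasGaussianLaw (stepIntegral hμ c) μ := by
  refine HasGaussianLaw.congr ?_ (EventuallyEq.symm (hμ.stepIntegral_ae_eq c))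
  exact (hμ.isGaussianProcess.smul c).hasGaussianLaw_fun_sum

theorem integral_stepIntegral (hμ : IsWienerMeasure T μ) (c : Set.Icc (0 : ℝ) T →₀ ℝ) :
    ∫ ω, stepIntegral hμ c ω ∂μ = 0 := by
  have := hμ.isProbabilityMeasure
  rw [integral_congr_ae (hμ.stepIntegral_ae_eq c), integral_finsetSum]
  · simp [integral_const_mul, hμ.integral_eval]
  · exact fun s _ => ((hμ.memLp_eval s).integrable (by norm_num)).const_mul _

theorem integral_wienerIntegral_sq (hμ : IsWienerMeasure T μ) (f : L2T T) :
    ∫ ω, wienerIntegral hμ f ω ^ 2 ∂μ = ‖f‖ ^ 2 := by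
  rw [← hμ.norm_wienerIntegral, ← real_inner_self_eq_norm_sq, L2.inner_def]
  simp [pow_two]

theorem map_stepIntegral (hμ : IsWienerMeasure T μ) (c : Set.Icc (0 : ℝ) T →₀ ℝ) :
    μ.map (stepIntegral hμ c) = gaussianReal 0 (‖stepMap T c‖₊ ^ 2) := by
  have := hμ.isProbabilityMeasure
  rw [(hμ.hasGaussianLaw_stepIntegral c).map_eq_gaussianReal, hμ.integral_stepIntegral,
    variance_of_integral_eq_zero (Lp.aestronglyMeasurable _).aemeasurable
      (hμ.integral_stepIntegral c), ← hμ.wienerIntegral_stepMap, hμ.integral_wienerIntegral_sq]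
  congr 1
  ext
  simp

/-- Since `|e^{ia} - e^{ib}| ≤ |a - b|` and `δ` is isometric, the left side is Lipschitz in `f`, so
the Gaussian formula extends from step functions by density. -/
theorem charFun_map_wienerIntegral (hμ : IsWienerMeasure T μ) (f : L2T T) (t : ℝ) :
    charFun (μ.map (wienerIntegral hμ f)) t = Complex.exp (-(‖f‖ ^ 2 * t ^ 2 / 2)) := by
  have := hμ.isProbabilityMeasure
  have hchar (f : L2T T) : charFun (μ.map (wienerIntegral hμ f)) t
      = ∫ ω, Complex.exp (t * wienerIntegral hμ f ω * Complex.I) ∂μ := by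
    rw [charFun_apply_real, integral_map (hμ.measurable_wienerIntegral f).aemeasurable
      (by fun_prop)]
  have hint (f : L2T T) :
      Integrable (fun ω => Complex.exp (t * wienerIntegral hμ f ω * Complex.I)) μ := by
    refine Integrable.of_bound (C := 1) ?_ (ae_of_all _ fun ω => ?_)
    · have := hμ.measurable_wienerIntegral f
      fun_prop
    · rw [← Complex.ofReal_mul, Complex.norm_exp_ofReal_mul_I]
  have hlip : LipschitzWith ‖t‖₊ fun f => charFun (μ.map (wienerIntegral hμ f)) t := by
    refine LipschitzWith.of_dist_le_mul fun f g => ?_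
    rw [hchar, hchar, dist_eq_norm, ← integral_sub (hint f) (hint g), dist_eq_norm,
      ← hμ.norm_wienerIntegral, map_sub]
    calc ‖∫ ω, (Complex.exp (t * wienerIntegral hμ f ω * Complex.I)
          - Complex.exp (t * wienerIntegral hμ g ω * Complex.I)) ∂μ‖
        ≤ ∫ ω, ‖t‖ * ‖(wienerIntegral hμ f - wienerIntegral hμ g) ω‖ ∂μ := by
          refine norm_integral_le_of_norm_le ((Integrable.norm
            ((Lp.memLp _).integrable (by norm_num))).const_mul _) ?_
          filter_upwards [Lp.coeFn_sub (wienerIntegral hμ f) (wienerIntegral hμ g)] with ω hω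
          rw [hω, Pi.sub_apply, ← norm_mul, mul_sub]
          have key (a b : ℝ) : ‖Complex.exp (a * Complex.I) - Complex.exp (b * Complex.I)‖
              ≤ ‖a - b‖ := by
            have h1 : Complex.exp (a * Complex.I) - Complex.exp (b * Complex.I)
                = Complex.exp (b * Complex.I)
                  * (Complex.exp (Complex.I * ((a - b : ℝ) : ℂ)) - 1) := by
              rw [mul_sub, ← Complex.exp_add, mul_one]
              push_cast
              ring_nf
            rw [h1, norm_mul, Complex.norm_exp_ofReal_mul_I, one_mul]
            exact Real.norm_exp_I_mul_ofReal_sub_one_le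
          exact_mod_cast key (t * wienerIntegral hμ f ω) (t * wienerIntegral hμ g ω)
      _ = ‖t‖ * ∫ ω, ‖(wienerIntegral hμ f - wienerIntegral hμ g) ω‖ ∂μ := integral_const_mul _ _
      _ ≤ ‖t‖ * ‖wienerIntegral hμ f - wienerIntegral hμ g‖ := by
          gcongr
          rw [integral_norm_eq_lintegral_enorm (Lp.aestronglyMeasurable _), Lp.norm_def,
            ← eLpNorm_one_eq_lintegral_enorm]
          exact ENNReal.toReal_mono (Lp.eLpNorm_ne_top _) (eLpNorm_le_eLpNorm_of_exponent_le
            (by norm_num) (Lp.aestronglyMeasurable _))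
  refine (denseRange_stepMap T).induction_on (p := fun f : L2T T =>
    charFun (μ.map (wienerIntegral hμ f)) t = Complex.exp (-(‖f‖ ^ 2 * t ^ 2 / 2))) f
    (isClosed_eq hlip.continuous (by fun_prop)) fun c => ?_
  rw [hμ.wienerIntegral_stepMap, hμ.map_stepIntegral, charFun_gaussianReal]
  congr 1
  simp

/-- The Wiener integral `δ(f)` is a centered Gaussian random variable with variance `|f|²`. -/
theorem map_wienerIntegral (hμ : IsWienerMeasure T μ) (f : L2T T) :
    μ.map (wienerIntegral hμ f) = gaussianReal 0 (‖f‖₊ ^ 2) := by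
  have := hμ.isProbabilityMeasure
  have : IsProbabilityMeasure (μ.map (wienerIntegral hμ f)) :=
    Measure.isProbabilityMeasure_map (hμ.measurable_wienerIntegral f).aemeasurable
  refine Measure.ext_of_charFun (funext fun t => ?_)
  rw [hμ.charFun_map_wienerIntegral, charFun_gaussianReal]
  congr 1
  simp

theorem mgf_wienerIntegral (hμ : IsWienerMeasure T μ) (f : L2T T) (t : ℝ) :
    mgf (wienerIntegral hμ f) μ t = Real.exp (‖f‖ ^ 2 * t ^ 2 / 2) := by
  rw [mgf_gaussianReal (hμ.map_wienerIntegral f)]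
  simp

theorem integral_exp_wienerIntegral (hμ : IsWienerMeasure T μ) (f : L2T T) :
    ∫ ω, Real.exp (wienerIntegral hμ f ω) ∂μ = Real.exp (‖f‖ ^ 2 / 2) := by
  simpa [mgf] using hμ.mgf_wienerIntegral f 1

theorem integrable_exp_wienerIntegral (hμ : IsWienerMeasure T μ) (f : L2T T) :
    Integrable (fun ω => Real.exp (wienerIntegral hμ f ω)) μ := by
  -- The integral of a non-integrable function is `0` by convention, but the value found is
  -- positive.
  by_contra h
  have := hμ.integral_exp_wienerIntegral f
  rw [integral_undef h] at this
  exact (Real.exp_pos _).ne this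

theorem lintegral_exp_wienerIntegral (hμ : IsWienerMeasure T μ) (f : L2T T) :
    ∫⁻ ω, ENNReal.ofReal (Real.exp (wienerIntegral hμ f ω)) ∂μ
      = ENNReal.ofReal (Real.exp (‖f‖ ^ 2 / 2)) := by
  rw [← ofReal_integral_eq_lintegral_ofReal (hμ.integrable_exp_wienerIntegral f)
    (ae_of_all _ fun ω => (Real.exp_pos _).le), hμ.integral_exp_wienerIntegral]

theorem memLp_wienerIntegral (hμ : IsWienerMeasure T μ) (f : L2T T) {p : ℝ≥0∞} (hp : p ≠ ∞) :
    MemLp (wienerIntegral hμ f) p μ := by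
  have h := memLp_id_gaussianReal' (μ := 0) (v := ‖f‖₊ ^ 2) p hp
  rw [← hμ.map_wienerIntegral] at h
  exact (memLp_map_measure_iff (by fun_prop)
    (hμ.measurable_wienerIntegral f).aemeasurable).1 h

/-- `‖exp(δ(f))‖_r = exp(r|f|²/2)`. -/
theorem eLpNorm_exp_wienerIntegral (hμ : IsWienerMeasure T μ) (f : L2T T) {r : ℝ} (hr : 0 < r) :
    eLpNorm (fun ω => Real.exp (wienerIntegral hμ f ω)) (ENNReal.ofReal r) μ
      = ENNReal.ofReal (Real.exp (r * ‖f‖ ^ 2 / 2)) := by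
  rw [eLpNorm_eq_lintegral_rpow_enorm_toReal (by simpa using hr) ENNReal.ofReal_ne_top,
    ENNReal.toReal_ofReal hr.le]
  have h1 : ∫⁻ ω, ‖Real.exp (wienerIntegral hμ f ω)‖ₑ ^ r ∂μ
      = ENNReal.ofReal (Real.exp (‖r • f‖ ^ 2 / 2)) := by
    rw [← hμ.lintegral_exp_wienerIntegral]
    refine lintegral_congr_ae ?_
    filter_upwards [hμ.wienerIntegral_smul r f] with ω hω
    rw [hω, Real.enorm_eq_ofReal (Real.exp_pos _).le,
      ENNReal.ofReal_rpow_of_pos (Real.exp_pos _), ← Real.exp_mul, mul_comm]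
  rw [h1, ENNReal.ofReal_rpow_of_pos (Real.exp_pos _), ← Real.exp_mul, norm_smul,
    Real.norm_of_nonneg hr.le]
  congr 2
  field_simp

/-! ### Stochastic exponentials -/

theorem measurable_stochExp (hμ : IsWienerMeasure T μ) (f : L2T T) :
    Measurable (stochExp hμ f) := by
  have := hμ.measurable_wienerIntegral f
  unfold stochExp
  fun_prop

theorem stochExp_pos (hμ : IsWienerMeasure T μ) (f : L2T T) (ω : PathSpace T) :
    0 < stochExp hμ f ω := Real.exp_pos _

theorem stochExp_eq_mul (hμ : IsWienerMeasure T μ) (f : L2T T) (ω : PathSpace T) :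
    stochExp hμ f ω = Real.exp (-(‖f‖ ^ 2 / 2)) * Real.exp (wienerIntegral hμ f ω) := by
  rw [stochExp, ← Real.exp_add]
  ring_nf

theorem memLp_stochExp (hμ : IsWienerMeasure T μ) (f : L2T T) {p : ℝ≥0∞} (hp : p ≠ ∞) :
    MemLp (stochExp hμ f) p μ := by
  have := hμ.isProbabilityMeasure
  -- The norm formula needs a positive exponent; adding `1` also covers `p = 0`.
  have h : MemLp (stochExp hμ f) (ENNReal.ofReal (p.toReal + 1)) μ := by
    have h2 : stochExp hμ f = fun ω => Real.exp (-(‖f‖ ^ 2 / 2))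
        * Real.exp (wienerIntegral hμ f ω) := funext fun ω => hμ.stochExp_eq_mul f ω
    rw [h2]
    refine MemLp.const_mul ⟨?_, ?_⟩ _
    · have := hμ.measurable_wienerIntegral f
      fun_prop
    · rw [hμ.eLpNorm_exp_wienerIntegral f (by positivity)]
      exact ENNReal.ofReal_lt_top
  refine h.mono_exponent ?_
  rw [← ENNReal.ofReal_toReal hp, ENNReal.toReal_ofReal ENNReal.toReal_nonneg]
  exact ENNReal.ofReal_le_ofReal (by linarith)

theorem integral_stochExp (hμ : IsWienerMeasure T μ) (f : L2T T) :
    ∫ ω, stochExp hμ f ω ∂μ = 1 := by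
  simp_rw [hμ.stochExp_eq_mul f]
  rw [integral_const_mul, hμ.integral_exp_wienerIntegral, ← Real.exp_add]
  simp

theorem lintegral_stochExp (hμ : IsWienerMeasure T μ) (f : L2T T) :
    ∫⁻ ω, ENNReal.ofReal (stochExp hμ f ω) ∂μ = 1 := by
  rw [← ofReal_integral_eq_lintegral_ofReal
    (memLp_one_iff_integrable.1 (hμ.memLp_stochExp f ENNReal.one_ne_top))
    (ae_of_all _ fun ω => (hμ.stochExp_pos f ω).le), hμ.integral_stochExp, ENNReal.ofReal_one]

theorem stochExp_add (hμ : IsWienerMeasure T μ) (f g : L2T T) :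
    ∀ᵐ ω ∂μ, stochExp hμ (f + g) ω
      = stochExp hμ f ω * stochExp hμ g ω * Real.exp (-inner ℝ f g) := by
  filter_upwards [hμ.wienerIntegral_add f g] with ω hω
  rw [stochExp, stochExp, stochExp, hω, ← Real.exp_add, ← Real.exp_add, norm_add_sq_real]
  ring_nf

end IsWienerMeasure

/-! ### The Cameron-Martin theorem -/

/-- Writing the primitive as an inner product gives its linearity in `g` and, by Cauchy-Schwarz, the
sup norm bound. -/
theorem primitivePath_apply (g : L2T T) (t : Set.Icc (0 : ℝ) T) :
    primitivePath g t = inner ℝ (indLp t) g := by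
  change ∫ s in (0 : ℝ)..(t : ℝ), g s = _
  rw [indLp, L2.inner_indicatorConstLp_one, intervalIntegral.integral_of_le t.2.1,
    Measure.restrict_restrict measurableSet_Ioc]
  congr 2
  have hsub : Set.Ioc (0 : ℝ) t ⊆ Set.Icc 0 T := fun x hx => ⟨hx.1.le, hx.2.trans t.2.2⟩
  exact (Set.inter_eq_left.2 hsub).symm

theorem norm_indLp_le (t : Set.Icc (0 : ℝ) T) : ‖indLp t‖ ≤ √T := by
  refine Real.le_sqrt_of_sq_le ?_
  rw [← real_inner_self_eq_norm_sq, inner_indLp, min_self]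
  exact t.2.2

theorem primitivePath_sub (g g' : L2T T) :
    primitivePath (g - g') = primitivePath g - primitivePath g' := by
  ext t
  simp [primitivePath_apply, inner_sub_right]

theorem norm_primitivePath_le (g : L2T T) : ‖primitivePath g‖ ≤ √T * ‖g‖ := by
  refine (ContinuousMap.norm_le _ (by positivity)).2 fun t => ?_
  rw [primitivePath_apply]
  exact (norm_inner_le_norm _ _).trans (by gcongr; exact norm_indLp_le t)

theorem continuous_primitivePath : Continuous (primitivePath : L2T T → PathSpace T) := by
  have : LipschitzWith (Real.toNNReal √T) (primitivePath : L2T T → PathSpace T) := by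
    refine LipschitzWith.of_dist_le_mul fun g g' => ?_
    rw [dist_eq_norm, dist_eq_norm, ← primitivePath_sub, Real.coe_toNNReal _ (Real.sqrt_nonneg _)]
    exact norm_primitivePath_le _
  exact this.continuous

/-- The translation of paths by `∫₀^· g(s) ds`. -/
def shift (g : L2T T) (ω : PathSpace T) : PathSpace T := ω + primitivePath g

theorem continuous_shift (g : L2T T) : Continuous (shift g) := by
  unfold shift
  fun_prop

theorem measurable_shift (g : L2T T) : Measurable (shift g) := (continuous_shift g).measurable

theorem shift_apply (g : L2T T) (ω : PathSpace T) (t : Set.Icc (0 : ℝ) T) :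
    shift g ω t = ω t + inner ℝ (indLp t) g := by
  simp [shift, primitivePath_apply]

/-- Two finite measures on the path space with the same finite-dimensional distributions agree. -/
theorem measure_pathSpace_ext {ν ν' : Measure (PathSpace T)} [IsFiniteMeasure ν]
    [IsFiniteMeasure ν']
    (h : ∀ I : Finset (Set.Icc (0 : ℝ) T), ν.map (fun ω (i : I) => ω i)
      = ν'.map (fun ω (i : I) => ω i)) : ν = ν' := by
  classical
  obtain ⟨D, hDc, hD⟩ := TopologicalSpace.exists_countable_dense (Set.Icc (0 : ℝ) T)
  have : Countable D := hDc
  let e : PathSpace T → D → ℝ := fun ω d => ω d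
  have hec : Continuous e := by unfold e; fun_prop
  have hei : Function.Injective e := by
    intro ω ω' hω
    refine DFunLike.coe_injective (Continuous.ext_on hD ω.continuous ω'.continuous fun d hd => ?_)
    exact congrFun hω ⟨d, hd⟩
  -- A continuous injection of a Polish space is a measurable embedding, so a measure is recovered
  -- from its image in the countable product, where finite marginals determine it.
  have hemb : MeasurableEmbedding e := hec.measurableEmbedding hei
  have hmap : ν.map e = ν'.map e := by
    have hlim (ρ : Measure (PathSpace T)) : IsProjectiveLimit (ρ.map e)
        (fun I : Finset D => (ρ.map (fun ω (i : I.image Subtype.val) => ω i)).map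
          (fun x (i : I) => x ⟨i.1.1, Finset.mem_image_of_mem _ i.2⟩)) := by
      intro I
      dsimp only
      rw [Measure.map_map (by fun_prop) hec.measurable, Measure.map_map]
      · rfl
      · fun_prop
      · exact (Continuous.measurable (by fun_prop))
    have h1 := hlim ν
    simp_rw [h] at h1
    have : ∀ I : Finset D, IsFiniteMeasure
        ((ν'.map (fun ω (i : I.image Subtype.val) => ω i)).map
          (fun x (i : I) => x ⟨i.1.1, Finset.mem_image_of_mem _ i.2⟩)) := fun I => inferInstance
    exact h1.unique (hlim ν')
  rw [← hemb.comap_map ν, hmap, hemb.comap_map]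

namespace IsWienerMeasure

theorem wienerIntegral_sum_indLp (hμ : IsWienerMeasure T μ) {ι : Type*} [Fintype ι]
    (s : ι → Set.Icc (0 : ℝ) T) (a : ι → ℝ) :
    ∀ᵐ ω ∂μ, wienerIntegral hμ (∑ i, a i • indLp (s i)) ω = ∑ i, a i * ω (s i) := by
  rw [map_sum]
  have h2 : ∀ᵐ ω ∂μ, ∀ i, wienerIntegral hμ (a i • indLp (s i)) ω = a i * ω (s i) := by
    refine ae_all_iff.2 fun i => ?_
    filter_upwards [hμ.wienerIntegral_smul (a i) (indLp (s i)), (hμ.memLp_eval (s i)).coeFn_toLp]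
      with ω h3 h4
    rw [h3, wienerIntegral_indLp, h4]
  filter_upwards [h2, Lp.coeFn_finsetSum Finset.univ fun i => wienerIntegral hμ (a i • indLp (s i))]
    with ω h3 h4
  rw [h4, Finset.sum_apply]
  exact Finset.sum_congr rfl fun i _ => h3 i

theorem integral_exp_wienerIntegral_mul_stochExp (hμ : IsWienerMeasure T μ) (f g : L2T T) (z : ℝ) :
    ∫ ω, Real.exp (z * wienerIntegral hμ f ω) * stochExp hμ g ω ∂μ
      = Real.exp (‖f‖ ^ 2 * z ^ 2 / 2 + z * inner ℝ f g) := by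
  have h1 : ∀ᵐ ω ∂μ, Real.exp (z * wienerIntegral hμ f ω) * stochExp hμ g ω
      = Real.exp (-(‖g‖ ^ 2 / 2)) * Real.exp (wienerIntegral hμ (z • f + g) ω) := by
    filter_upwards [hμ.wienerIntegral_add (z • f) g, hμ.wienerIntegral_smul z f] with ω h1 h2
    rw [stochExp, h1, h2, ← Real.exp_add, ← Real.exp_add]
    ring_nf
  rw [integral_congr_ae h1, integral_const_mul, hμ.integral_exp_wienerIntegral, ← Real.exp_add,
    norm_add_sq_real, norm_smul, inner_smul_left, mul_pow]
  simp only [Real.norm_eq_abs, sq_abs, conj_trivial]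
  ring_nf

/-- Both real moment generating functions equal the same Gaussian expression, finite everywhere.
Analytic continuation to `i` then identifies the characteristic functions. -/
theorem complexMGF_shift (hμ : IsWienerMeasure T μ) {ι : Type*} [Fintype ι]
    (s : ι → Set.Icc (0 : ℝ) T) (a : ι → ℝ) (g : L2T T) :
    complexMGF (fun ω => ∑ i, a i * shift g ω (s i)) μ Complex.I
      = complexMGF (fun ω => ∑ i, a i * ω (s i))
        (μ.withDensity fun ω => ENNReal.ofReal (stochExp hμ g ω)) Complex.I := by
  have := hμ.isProbabilityMeasure
  set f : L2T T := ∑ i, a i • indLp (s i) with hf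
  have hδ : (fun ω : PathSpace T => ∑ i, a i * ω (s i)) =ᵐ[μ] wienerIntegral hμ f :=
    EventuallyEq.symm (hμ.wienerIntegral_sum_indLp s a)
  have hsh : (fun ω : PathSpace T => ∑ i, a i * shift g ω (s i))
      = fun ω => (∑ i, a i * ω (s i)) + inner ℝ f g := by
    ext ω
    simp [shift_apply, hf, sum_inner, inner_smul_left, mul_add, Finset.sum_add_distrib]
  have hY : Measurable fun ω : PathSpace T => ∑ i, a i * ω (s i) :=
    Continuous.measurable (by fun_prop)
  have hmgf1 : mgf (fun ω => ∑ i, a i * shift g ω (s i)) μ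
      = fun z => Real.exp (‖f‖ ^ 2 * z ^ 2 / 2 + z * inner ℝ f g) := by
    ext z
    rw [hsh, mgf_add_const, mgf_congr hδ, hμ.mgf_wienerIntegral, Real.exp_add]
  have hmgf2 : mgf (fun ω => ∑ i, a i * ω (s i))
      (μ.withDensity fun ω => ENNReal.ofReal (stochExp hμ g ω))
      = fun z => Real.exp (‖f‖ ^ 2 * z ^ 2 / 2 + z * inner ℝ f g) := by
    ext z
    rw [mgf, integral_withDensity_eq_integral_toReal_smul
      (hμ.measurable_stochExp g).ennreal_ofReal (by simp),
      ← hμ.integral_exp_wienerIntegral_mul_stochExp]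
    refine integral_congr_ae ?_
    filter_upwards [hδ] with ω hω
    rw [hω, ENNReal.toReal_ofReal (hμ.stochExp_pos g ω).le, smul_eq_mul, mul_comm]
  refine eqOn_complexMGF_of_mgf (hmgf1.trans hmgf2.symm) ?_
  have huniv : integrableExpSet (fun ω => ∑ i, a i * shift g ω (s i)) μ = Set.univ := by
    refine Set.eq_univ_of_forall fun z => ?_
    by_contra hz
    have h2 := congrFun hmgf1 z
    rw [mgf, integral_undef hz] at h2
    exact (Real.exp_pos _).ne h2
  simp [huniv]

/-- The Cameron-Martin theorem. -/
theorem map_shift (hμ : IsWienerMeasure T μ) (g : L2T T) :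
    μ.map (shift g) = μ.withDensity fun ω => ENNReal.ofReal (stochExp hμ g ω) := by
  have := hμ.isProbabilityMeasure
  have hfin : IsFiniteMeasure (μ.withDensity fun ω => ENNReal.ofReal (stochExp hμ g ω)) :=
    isFiniteMeasure_withDensity (by rw [hμ.lintegral_stochExp]; exact ENNReal.one_ne_top)
  refine measure_pathSpace_ext fun I => Measure.ext_of_charFunDual (funext fun L => ?_)
  classical
  have hL (x : I → ℝ) : L x = ∑ i, L (Pi.single i 1) * x i := by
    conv_lhs => rw [← L.sum_comp_single]
    refine Finset.sum_congr rfl fun i _ => ?_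
    have : (Pi.single i (x i) : I → ℝ) = x i • Pi.single i 1 := by
      ext j
      by_cases hj : j = i
      · subst hj; simp
      · simp [hj]
    simp only [ContinuousLinearMap.comp_apply, ContinuousLinearMap.single_apply]
    rw [this, map_smul, smul_eq_mul, mul_comm]
  have hm : Measurable fun (ω : PathSpace T) (i : I) => ω i := Continuous.measurable (by fun_prop)
  -- With coefficients `L(e_i)`, the value at `i` is the characteristic function of the marginal at
  -- the functional `L`.
  have key := hμ.complexMGF_shift (fun i : I => (i : Set.Icc (0 : ℝ) T))
    (fun i => L (Pi.single i 1)) g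
  have hsm := measurable_shift g
  rw [charFunDual_apply, charFunDual_apply, integral_map hm.aemeasurable (by fun_prop),
    integral_map hm.aemeasurable (by fun_prop), integral_map (measurable_shift g).aemeasurable
      (Continuous.aestronglyMeasurable (by fun_prop))]
  simp only [complexMGF] at key
  convert key using 3 with ω ω
  all_goals rw [hL, mul_comm]

/-- This makes translation well defined on almost sure classes and lets almost sure identities be
evaluated at translated paths. -/
theorem quasiMeasurePreserving_shift (hμ : IsWienerMeasure T μ) (g : L2T T) :
    Measure.QuasiMeasurePreserving (shift g) μ μ :=
  ⟨measurable_shift g, by rw [hμ.map_shift g]; exact withDensity_absolutelyContinuous _ _⟩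

theorem integral_comp_shift (hμ : IsWienerMeasure T μ) (g : L2T T) {F : PathSpace T → ℝ}
    (hF : AEStronglyMeasurable F μ) :
    ∫ ω, F (shift g ω) ∂μ = ∫ ω, F ω * stochExp hμ g ω ∂μ := by
  rw [← integral_map (measurable_shift g).aemeasurable
    (hF.mono_ac (hμ.quasiMeasurePreserving_shift g).absolutelyContinuous), hμ.map_shift g,
    integral_withDensity_eq_integral_toReal_smul
      (hμ.measurable_stochExp g).ennreal_ofReal (by simp)]
  refine integral_congr_ae (ae_of_all _ fun ω => ?_)
  simp only [ENNReal.toReal_ofReal (hμ.stochExp_pos g ω).le, smul_eq_mul, mul_comm]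

theorem lintegral_comp_shift (hμ : IsWienerMeasure T μ) (g : L2T T) {F : PathSpace T → ℝ≥0∞}
    (hF : AEMeasurable F μ) :
    ∫⁻ ω, F (shift g ω) ∂μ = ∫⁻ ω, F ω * ENNReal.ofReal (stochExp hμ g ω) ∂μ := by
  rw [← lintegral_map' (hF.mono_ac (hμ.quasiMeasurePreserving_shift g).absolutelyContinuous)
    (measurable_shift g).aemeasurable, hμ.map_shift g,
    lintegral_withDensity_eq_lintegral_mul₀ (hμ.measurable_stochExp g).ennreal_ofReal.aemeasurable
      hF]
  refine lintegral_congr fun ω => ?_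
  simp [mul_comm]

end IsWienerMeasure

/-! ### Translation of the Wiener integral and of random variables -/

namespace IsWienerMeasure

theorem wienerIntegral_stepMap_shift (hμ : IsWienerMeasure T μ) (c : Set.Icc (0 : ℝ) T →₀ ℝ)
    (g : L2T T) :
    ∀ᵐ ω ∂μ, wienerIntegral hμ (stepMap T c) (shift g ω)
      = wienerIntegral hμ (stepMap T c) ω + inner ℝ (stepMap T c) g := by
  have h1 := hμ.stepIntegral_ae_eq c
  rw [← hμ.wienerIntegral_stepMap] at h1
  filter_upwards [h1, (hμ.quasiMeasurePreserving_shift g).ae h1] with ω h2 h3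
  rw [h2, h3, stepMap, Finsupp.linearCombination_apply, Finsupp.sum, sum_inner,
    ← Finset.sum_add_distrib]
  refine Finset.sum_congr rfl fun s _ => ?_
  rw [shift_apply, inner_smul_left, conj_trivial]
  ring

/-- For step functions the identity is a finite computation with path values. In general,
approximate `f` and take a subsequence along which the integrals converge almost surely; by
quasi-invariance they converge at the translated path too. -/
theorem wienerIntegral_shift (hμ : IsWienerMeasure T μ) (f g : L2T T) :
    ∀ᵐ ω ∂μ, wienerIntegral hμ f (shift g ω) = wienerIntegral hμ f ω + inner ℝ f g := by
  obtain ⟨x, hx⟩ := mem_closure_iff_seq_limit.1 ((denseRange_stepMap T) f)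
  obtain ⟨hxr, hxf⟩ := hx
  choose c hc using hxr
  have hlim : Tendsto (fun n => wienerIntegral hμ (x n)) atTop (𝓝 (wienerIntegral hμ f)) :=
    ((wienerIntegral hμ).continuous.tendsto f).comp hxf
  obtain ⟨ns, hns, hae⟩ := (tendstoInMeasure_of_tendsto_Lp hlim).exists_seq_tendsto_ae
  have h1 : ∀ᵐ ω ∂μ, ∀ n, wienerIntegral hμ (x n) (shift g ω)
      = wienerIntegral hμ (x n) ω + inner ℝ (x n) g := by
    refine ae_all_iff.2 fun n => ?_
    rw [← hc n]
    exact hμ.wienerIntegral_stepMap_shift (c n) g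
  filter_upwards [hae, (hμ.quasiMeasurePreserving_shift g).ae hae, h1] with ω h2 h3 h4
  refine tendsto_nhds_unique h3 ?_
  simp_rw [h4]
  refine h2.add ?_
  have h5 : Tendsto (fun n => inner ℝ (x n) g) atTop (𝓝 (inner ℝ f g)) := hxf.inner tendsto_const_nhds
  exact h5.comp hns.tendsto_atTop

theorem stochExp_shift (hμ : IsWienerMeasure T μ) (f g : L2T T) :
    ∀ᵐ ω ∂μ, stochExp hμ f (shift g ω) = Real.exp (inner ℝ f g) * stochExp hμ f ω := by
  filter_upwards [hμ.wienerIntegral_shift f g] with ω hω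
  rw [stochExp, stochExp, hω, ← Real.exp_add]
  ring_nf

end IsWienerMeasure

/-! ### Boundedness and strong continuity of translations from `L^p` to `L^q` -/

section Bounds

variable {E : Type*} [NormedAddCommGroup E]

/-- A bound for the norm of the translations `T_g`, `|g| ≤ M`, from `𝓛^p` to `𝓛^q`. -/
def shiftBound (p q : ℝ≥0∞) (M : ℝ) : ℝ≥0∞ :=
  ENNReal.ofReal (Real.exp ((q⁻¹ - p⁻¹)⁻¹.toReal * M ^ 2 / 2))

theorem shiftBound_ne_top (p q : ℝ≥0∞) (M : ℝ) : shiftBound p q M ≠ ∞ := ENNReal.ofReal_ne_top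

theorem shiftBound_ne_zero (p q : ℝ≥0∞) (M : ℝ) : shiftBound p q M ≠ 0 := by
  simp [shiftBound, Real.exp_pos]

namespace IsWienerMeasure

theorem aestronglyMeasurable_comp_shift (hμ : IsWienerMeasure T μ) (g : L2T T)
    {F : PathSpace T → E} (hF : AEStronglyMeasurable F μ) :
    AEStronglyMeasurable (fun ω => F (shift g ω)) μ :=
  hF.comp_quasiMeasurePreserving (hμ.quasiMeasurePreserving_shift g)

/-- By Cameron-Martin the left side is `‖𝓔(g)^{1/q} F‖_q`. Hölder with `1/q = 1/r + 1/p` separates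
the factors, and `𝓔(g)^{1/q} ≤ exp δ(g/q)` has an explicit `L^r` bound since `|g/q| ≤ M`. -/
theorem eLpNorm_comp_shift_le (hμ : IsWienerMeasure T μ) [NormedSpace ℝ E] {p q : ℝ≥0∞}
    (hq : 1 ≤ q) (hqp : q < p) {M : ℝ} {g : L2T T} (hg : ‖g‖ ≤ M) {F : PathSpace T → E}
    (hF : AEStronglyMeasurable F μ) :
    eLpNorm (fun ω => F (shift g ω)) q μ ≤ shiftBound p q M * eLpNorm F p μ := by
  have hq0 : q ≠ 0 := (zero_lt_one.trans_le hq).ne'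
  have hqt : q ≠ ∞ := (hqp.trans_le le_top).ne
  have hq1 : 1 ≤ q.toReal := by
    rw [← ENNReal.toReal_one]; exact ENNReal.toReal_mono hqt hq
  have hlt : p⁻¹ < q⁻¹ := ENNReal.inv_lt_inv.2 hqp
  set r := (q⁻¹ - p⁻¹)⁻¹ with hr
  have hr0 : r ≠ 0 := by
    rw [hr, ENNReal.inv_ne_zero]
    exact ENNReal.sub_ne_top (ENNReal.inv_ne_top.2 hq0)
  have hrt : r ≠ ∞ := by
    rw [hr, ENNReal.inv_ne_top]
    exact (tsub_pos_of_lt hlt).ne'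
  have hrpos : 0 < r.toReal := ENNReal.toReal_pos hr0 hrt
  have : ENNReal.HolderTriple r p q := ⟨by rw [hr, inv_inv, tsub_add_cancel_of_le hlt.le]⟩
  set φ : PathSpace T → ℝ := fun ω => stochExp hμ g ω ^ (1 / q.toReal) with hφ
  have hφm : AEStronglyMeasurable φ μ :=
    ((hμ.measurable_stochExp g).pow_const _).aestronglyMeasurable
  have h1 : eLpNorm (fun ω => F (shift g ω)) q μ = eLpNorm (φ • F) q μ := by
    rw [eLpNorm_eq_lintegral_rpow_enorm_toReal hq0 hqt, eLpNorm_eq_lintegral_rpow_enorm_toReal hq0 hqt,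
      hμ.lintegral_comp_shift g (F := fun ω => ‖F ω‖ₑ ^ q.toReal) (hF.enorm.pow_const _)]
    congr 1
    refine lintegral_congr fun ω => ?_
    have hpos := hμ.stochExp_pos g ω
    rw [Pi.smul_apply', enorm_smul, ENNReal.mul_rpow_of_nonneg _ _ (by positivity), mul_comm]
    congr 1
    rw [Real.enorm_eq_ofReal (by positivity), ENNReal.ofReal_rpow_of_pos (by positivity), hφ]
    congr 1
    rw [← Real.rpow_mul hpos.le, one_div_mul_cancel (by positivity), Real.rpow_one]
  have h2 : eLpNorm φ r μ ≤ shiftBound p q M := by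
    have h3 : eLpNorm φ r μ
        ≤ eLpNorm (fun ω => Real.exp (wienerIntegral hμ (q.toReal⁻¹ • g) ω)) r μ := by
      refine eLpNorm_mono_ae ?_
      filter_upwards [hμ.wienerIntegral_smul q.toReal⁻¹ g] with ω hω
      have hpos := hμ.stochExp_pos g ω
      rw [Real.norm_of_nonneg (by positivity), Real.norm_of_nonneg (by positivity), hω, hφ]
      dsimp only
      rw [stochExp, ← Real.exp_mul]
      refine Real.exp_le_exp.2 ?_
      have : 0 ≤ ‖g‖ ^ 2 / 2 * (1 / q.toReal) := by positivity
      rw [sub_mul, one_div] at *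
      linarith
    refine h3.trans ?_
    conv_lhs => rw [← ENNReal.ofReal_toReal hrt]
    rw [hμ.eLpNorm_exp_wienerIntegral _ hrpos, shiftBound, ← hr]
    refine ENNReal.ofReal_le_ofReal (Real.exp_le_exp.2 ?_)
    have h4 : ‖q.toReal⁻¹ • g‖ ≤ M := by
      rw [norm_smul, Real.norm_of_nonneg (by positivity)]
      exact (mul_le_of_le_one_left (norm_nonneg _) (inv_le_one_of_one_le₀ hq1)).trans hg
    gcongr
  rw [h1]
  exact (eLpNorm_smul_le_mul_eLpNorm hF hφm).trans (by gcongr)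

theorem memLp_comp_shift (hμ : IsWienerMeasure T μ) [NormedSpace ℝ E] {p q : ℝ≥0∞}
    (hq : 1 ≤ q) (hqp : q < p) (g : L2T T) {F : PathSpace T → E} (hF : MemLp F p μ) :
    MemLp (fun ω => F (shift g ω)) q μ :=
  ⟨hμ.aestronglyMeasurable_comp_shift g hF.1, (hμ.eLpNorm_comp_shift_le hq hqp le_rfl hF.1).trans_lt
    (ENNReal.mul_lt_top (shiftBound_ne_top _ _ _).lt_top hF.2)⟩

/-- Dominated convergence: the translated path depends continuously on `g'` in sup norm, and `2‖G‖`
dominates. -/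
theorem tendsto_eLpNorm_boundedContinuous_shift (hμ : IsWienerMeasure T μ) {q : ℝ≥0∞}
    (hq : 1 ≤ q) (hqt : q ≠ ∞) (G : BoundedContinuousFunction (PathSpace T) E) (g : L2T T) :
    Tendsto (fun g' => eLpNorm (fun ω => G (shift g' ω) - G (shift g ω)) q μ) (𝓝 g) (𝓝 0) := by
  have := hμ.isProbabilityMeasure
  have hq0 : q ≠ 0 := (zero_lt_one.trans_le hq).ne'
  have hqpos : 0 < q.toReal := ENNReal.toReal_pos hq0 hqt
  simp_rw [eLpNorm_eq_lintegral_rpow_enorm_toReal hq0 hqt]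
  have hcont (g' : L2T T) : Continuous fun ω => G (shift g' ω) - G (shift g ω) :=
    (G.continuous.comp (continuous_shift g')).sub (G.continuous.comp (continuous_shift g))
  have h1 : Tendsto (fun g' => ∫⁻ ω, ‖G (shift g' ω) - G (shift g ω)‖ₑ ^ q.toReal ∂μ) (𝓝 g)
      (𝓝 (∫⁻ _, 0 ∂μ)) := by
    refine tendsto_lintegral_filter_of_dominated_convergence
      (fun _ => (ENNReal.ofReal (2 * ‖G‖)) ^ q.toReal) ?_ ?_ ?_ ?_
    · exact Eventually.of_forall fun g' => ((hcont g').enorm.measurable.pow_const _)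
    · refine Eventually.of_forall fun g' => ae_of_all _ fun ω => ?_
      gcongr
      rw [← ofReal_norm]
      exact ENNReal.ofReal_le_ofReal ((dist_eq_norm (G _) (G _)).symm.trans_le
        (G.dist_le_two_norm _ _))
    · rw [lintegral_const, measure_univ, mul_one]
      exact ENNReal.rpow_ne_top_of_nonneg hqpos.le ENNReal.ofReal_ne_top
    · refine ae_of_all _ fun ω => ?_
      have h2 : Continuous fun g' => ‖G (shift g' ω) - G (shift g ω)‖ₑ ^ q.toReal := by
        refine ENNReal.continuous_rpow_const.comp (continuous_enorm.comp (Continuous.sub ?_ ?_))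
        · exact G.continuous.comp (continuous_const.add continuous_primitivePath)
        · exact continuous_const
      have h3 := h2.tendsto g
      simpa [hqpos] using h3
  simp only [lintegral_zero] at h1
  have h4 := ((ENNReal.continuous_rpow_const (y := 1 / q.toReal)).tendsto 0).comp h1
  rw [ENNReal.zero_rpow_of_pos (by positivity)] at h4
  exact h4

/-- Strong continuity of the translations from `𝓛^p` to `𝓛^q`, `q < p`. -/
theorem tendsto_eLpNorm_comp_shift (hμ : IsWienerMeasure T μ) [NormedSpace ℝ E] {p q : ℝ≥0∞}
    (hq : 1 ≤ q) (hqp : q < p) (hp : p ≠ ∞) {F : PathSpace T → E} (hF : MemLp F p μ) (g : L2T T) :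
    Tendsto (fun g' => eLpNorm (fun ω => F (shift g' ω) - F (shift g ω)) q μ) (𝓝 g) (𝓝 0) := by
  have := hμ.isProbabilityMeasure
  refine ENNReal.tendsto_nhds_zero.2 fun ε hε => ?_
  -- One constant serves all `g'` within distance `1` of `g`; the rest is an `ε/3` argument with a
  -- bounded continuous approximation of `F`.
  set C := shiftBound p q (‖g‖ + 1) with hC
  have hC0 : C ≠ 0 := shiftBound_ne_zero _ _ _
  have hCt : C ≠ ∞ := shiftBound_ne_top _ _ _
  have hε3 : ε / 3 ≠ 0 := (ENNReal.div_pos hε.ne' (by norm_num)).ne'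
  obtain ⟨G, hG, hGm⟩ := hF.exists_boundedContinuous_eLpNorm_sub_le hp
    (ε := ε / 3 / C) (ENNReal.div_pos hε3 hCt).ne'
  have hmeas : AEStronglyMeasurable (F - (G : PathSpace T → E)) μ := hF.1.sub hGm.1
  have hbound (g' : L2T T) (hg' : ‖g'‖ ≤ ‖g‖ + 1) :
      eLpNorm (fun ω => (F - (G : PathSpace T → E)) (shift g' ω)) q μ ≤ ε / 3 :=
    calc _ ≤ C * eLpNorm (F - (G : PathSpace T → E)) p μ :=
          hμ.eLpNorm_comp_shift_le hq hqp hg' hmeas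
      _ ≤ C * (ε / 3 / C) := by gcongr
      _ = ε / 3 := ENNReal.mul_div_cancel hC0 hCt
  have hqt : q ≠ ∞ := (hqp.trans_le le_top).ne
  have hnear : ∀ᶠ g' in 𝓝 g, ‖g'‖ ≤ ‖g‖ + 1 := by
    have := (continuous_norm.tendsto g).eventually (gt_mem_nhds (lt_add_one ‖g‖))
    exact this.mono fun _ h => h.le
  filter_upwards [hnear, ENNReal.tendsto_nhds_zero.1
    (hμ.tendsto_eLpNorm_boundedContinuous_shift hq hqt G g) (ε / 3) (pos_iff_ne_zero.2 hε3)]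
    with g' h1 h2
  have hsplit : (fun ω => F (shift g' ω) - F (shift g ω))
      = (fun ω => (F - (G : PathSpace T → E)) (shift g' ω))
        + (fun ω => G (shift g' ω) - G (shift g ω))
        - (fun ω => (F - (G : PathSpace T → E)) (shift g ω)) := by
    ext ω
    simp only [Pi.add_apply, Pi.sub_apply]
    abel
  have hm (g' : L2T T) := hμ.aestronglyMeasurable_comp_shift g' hmeas
  have hGm' : AEStronglyMeasurable (fun ω => G (shift g' ω) - G (shift g ω)) μ :=
    (hμ.aestronglyMeasurable_comp_shift g' hGm.1).sub (hμ.aestronglyMeasurable_comp_shift g hGm.1)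
  rw [hsplit]
  calc _ ≤ _ := eLpNorm_sub_le ((hm g').add hGm') (hm g) hq
    _ ≤ (ε / 3 + ε / 3) + ε / 3 := by
      gcongr
      · exact (eLpNorm_add_le (hm g') hGm' hq).trans (add_le_add (hbound g' h1) h2)
      · exact hbound g (by linarith [norm_nonneg g])
    _ = ε := ENNReal.add_thirds ε

end IsWienerMeasure

end Bounds

/-! ### Differentiability of the stochastic exponential -/

theorem conjExponent_ne_top {p : ℝ≥0∞} (hp : 1 < p) : ENNReal.conjExponent p ≠ ∞ :=
  ENNReal.add_ne_top.2 ⟨ENNReal.one_ne_top, ENNReal.inv_ne_top.2 (tsub_pos_of_lt hp).ne'⟩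

theorem abs_exp_sub_one_sub_id_le_sq_mul_exp (y : ℝ) :
    |Real.exp y - 1 - y| ≤ y ^ 2 * Real.exp |y| := by
  have h := Complex.norm_exp_sub_sum_le_norm_mul_exp (y : ℂ) 2
  simp only [Finset.sum_range_succ, Finset.sum_range_zero, pow_zero, Nat.factorial, Nat.cast_one,
    div_one, zero_add, pow_one, Complex.norm_real, Real.norm_eq_abs, sq_abs, mul_one] at h
  rw [← Real.norm_eq_abs, ← Complex.norm_real]
  push_cast
  rwa [sub_sub]

/-- Second order Taylor bound for `𝓔(K + εw)/𝓔(K)`, with `x = δ(w)`, `b = ⟨K, w⟩`, `n = |w|²`.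
Bounding by `e^{±2x}` keeps the estimate within exponentials of Wiener integrals, whose norms are
explicit. -/
theorem abs_exp_remainder_le {ε x b n m : ℝ} (hε0 : 0 ≤ ε) (hε1 : ε ≤ 1) (hb : |b| ≤ m)
    (hn0 : 0 ≤ n) (hn1 : n ≤ 1) :
    |Real.exp (ε * x - ε * b - ε ^ 2 * n / 2) - 1 - ε * (x - b)|
      ≤ ε ^ 2 * (3 * Real.exp (2 * (m + 1)) * (Real.exp (2 * x) + Real.exp (-2 * x))) := by
  set y := ε * x - ε * b - ε ^ 2 * n / 2 with hy
  -- Chosen so that `|y| ≤ εz`; then `z² ≤ 2e^z` absorbs the polynomial factor.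
  set z := |x| + (m + 1) with hz
  have hz0 : 0 ≤ z := by have := abs_nonneg x; have := abs_nonneg b; linarith
  have hyz : |y| ≤ ε * z := by
    have h1 : |x - b - ε * n / 2| ≤ z := by
      have h2 : 0 ≤ ε * n := by positivity
      have h3 : ε * n ≤ 1 := mul_le_one₀ hε1 hn0 hn1
      rw [abs_le] at *
      have h4 := neg_abs_le x
      have h5 := le_abs_self x
      constructor <;> linarith [hb.1, hb.2]
    have h6 : y = ε * (x - b - ε * n / 2) := by rw [hy]; ring
    rw [h6, abs_mul, abs_of_nonneg hε0]
    gcongr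
  have hyz' : |y| ≤ z := hyz.trans (mul_le_of_le_one_left hz0 hε1)
  have hy2 : y ^ 2 ≤ ε ^ 2 * z ^ 2 := by
    rw [← mul_pow, ← sq_abs]
    gcongr
  have hz2 : z ^ 2 ≤ 2 * Real.exp z := by
    have := Real.quadratic_le_exp_of_nonneg hz0
    linarith
  have hmain : |Real.exp y - 1 - y| ≤ ε ^ 2 * (2 * Real.exp (2 * z)) :=
    calc _ ≤ y ^ 2 * Real.exp |y| := abs_exp_sub_one_sub_id_le_sq_mul_exp y
      _ ≤ (ε ^ 2 * z ^ 2) * Real.exp z := by gcongr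
      _ ≤ (ε ^ 2 * (2 * Real.exp z)) * Real.exp z := by gcongr
      _ = ε ^ 2 * (2 * Real.exp (2 * z)) := by
        have h2z : Real.exp (2 * z) = Real.exp z * Real.exp z := by rw [two_mul, Real.exp_add]
        rw [h2z, mul_assoc, mul_assoc]
  have h1 : (1 : ℝ) ≤ Real.exp (2 * z) := Real.one_le_exp (by positivity)
  have h2 : Real.exp (2 * z)
      ≤ Real.exp (2 * (m + 1)) * (Real.exp (2 * x) + Real.exp (-2 * x)) := by
    have h3 : Real.exp (2 * z) = Real.exp (2 * (m + 1)) * Real.exp (2 * |x|) := by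
      rw [← Real.exp_add, hz]; ring_nf
    rw [h3]
    gcongr
    rcases abs_choice x with h | h <;> rw [h]
    · linarith [Real.exp_pos (-2 * x)]
    · rw [mul_neg, ← neg_mul]
      linarith [Real.exp_pos (2 * x)]
  have h4 : Real.exp y - 1 - ε * (x - b) = (Real.exp y - 1 - y) - ε ^ 2 * (n / 2) := by
    rw [hy]; ring
  rw [h4]
  calc |Real.exp y - 1 - y - ε ^ 2 * (n / 2)| ≤ |Real.exp y - 1 - y| + |ε ^ 2 * (n / 2)| :=
        abs_sub _ _
    _ ≤ ε ^ 2 * (2 * Real.exp (2 * z)) + ε ^ 2 * Real.exp (2 * z) := by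
      gcongr
      rw [abs_of_nonneg (by positivity)]
      gcongr
      linarith
    _ = ε ^ 2 * (3 * Real.exp (2 * z)) := by ring
    _ ≤ _ := by
      rw [mul_assoc 3]
      gcongr

namespace IsWienerMeasure

/-- The derivative of `K ↦ 𝓔(K)` in the direction `v`. -/
def stochExpDeriv (hμ : IsWienerMeasure T μ) (K v : L2T T) (ω : PathSpace T) : ℝ :=
  stochExp hμ K ω * (wienerIntegral hμ v ω - inner ℝ K v)

theorem memLp_mul_of_forall {F G : PathSpace T → ℝ}
    (hF : ∀ r : ℝ≥0∞, r ≠ ∞ → MemLp F r μ) (hG : ∀ r : ℝ≥0∞, r ≠ ∞ → MemLp G r μ)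
    {r : ℝ≥0∞} (hr : r ≠ ∞) : MemLp (fun ω => F ω * G ω) r μ := by
  have : ENNReal.HolderTriple (r * 2) (r * 2) r := ⟨by
    rw [ENNReal.mul_inv (Or.inr (by norm_num)) (Or.inr (by norm_num)), ← mul_add,
      ENNReal.inv_two_add_inv_two, mul_one]⟩
  have h2 : r * 2 ≠ ∞ := ENNReal.mul_ne_top hr (by norm_num)
  exact (hG _ h2).mul' (hF _ h2)

theorem memLp_wienerIntegral_sub_const (hμ : IsWienerMeasure T μ) (v : L2T T) (a : ℝ)
    {r : ℝ≥0∞} (hr : r ≠ ∞) : MemLp (fun ω => wienerIntegral hμ v ω - a) r μ := by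
  have := hμ.isProbabilityMeasure
  exact (hμ.memLp_wienerIntegral v hr).sub (memLp_const a)

theorem memLp_stochExpDeriv (hμ : IsWienerMeasure T μ) (K v : L2T T) {r : ℝ≥0∞} (hr : r ≠ ∞) :
    MemLp (hμ.stochExpDeriv K v) r μ :=
  memLp_mul_of_forall (fun _ h => hμ.memLp_stochExp K h)
    (fun _ h => hμ.memLp_wienerIntegral_sub_const v _ h) hr

theorem eLpNorm_exp_wienerIntegral_le (hμ : IsWienerMeasure T μ) {r : ℝ≥0∞} (hr1 : 1 ≤ r)
    (hr : r ≠ ∞) {f : L2T T} {M : ℝ} (hf : ‖f‖ ≤ M) :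
    eLpNorm (fun ω => Real.exp (wienerIntegral hμ f ω)) r μ
      ≤ ENNReal.ofReal (Real.exp (r.toReal * M ^ 2 / 2)) := by
  conv_lhs => rw [← ENNReal.ofReal_toReal hr]
  rw [hμ.eLpNorm_exp_wienerIntegral f
    (ENNReal.toReal_pos (zero_lt_one.trans_le hr1).ne' hr)]
  gcongr

theorem stochExp_le (hμ : IsWienerMeasure T μ) (f : L2T T) (ω : PathSpace T) :
    stochExp hμ f ω ≤ Real.exp (wienerIntegral hμ f ω) :=
  Real.exp_le_exp.2 (sub_le_self _ (by positivity))

theorem norm_stochExp_remainder_le (hμ : IsWienerMeasure T μ) (K w : L2T T) (hw : ‖w‖ ≤ 1)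
    {ε : ℝ} (hε0 : 0 ≤ ε) (hε1 : ε ≤ 1) :
    ∀ᵐ ω ∂μ, ‖stochExp hμ (K + ε • w) ω - stochExp hμ K ω - ε * hμ.stochExpDeriv K w ω‖
      ≤ ε ^ 2 * (3 * Real.exp (2 * (‖K‖ + 1))) *
        (Real.exp (wienerIntegral hμ (K + (2 : ℝ) • w) ω)
          + Real.exp (wienerIntegral hμ (K + (-2 : ℝ) • w) ω)) := by
  filter_upwards [hμ.wienerIntegral_add K (ε • w), hμ.wienerIntegral_smul ε w,
    hμ.wienerIntegral_add K ((2 : ℝ) • w), hμ.wienerIntegral_smul 2 w,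
    hμ.wienerIntegral_add K ((-2 : ℝ) • w), hμ.wienerIntegral_smul (-2) w] with ω h1 h2 h3 h4 h5 h6
  rw [h3, h4, h5, h6, Real.exp_add, Real.exp_add, ← mul_add]
  have hb : |inner ℝ K w| ≤ ‖K‖ :=
    (abs_real_inner_le_norm K w).trans (mul_le_of_le_one_right (norm_nonneg _) hw)
  have key := abs_exp_remainder_le (x := wienerIntegral hμ w ω) hε0 hε1 hb (sq_nonneg ‖w‖)
    (pow_le_one₀ (norm_nonneg _) hw)
  have h7 : stochExp hμ (K + ε • w) ω = stochExp hμ K ω *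
      Real.exp (ε * wienerIntegral hμ w ω - ε * inner ℝ K w - ε ^ 2 * ‖w‖ ^ 2 / 2) := by
    rw [stochExp, stochExp, h1, h2, ← Real.exp_add, norm_add_sq_real, norm_smul, inner_smul_right,
      mul_pow, Real.norm_eq_abs, sq_abs]
    ring_nf
  have h8 : stochExp hμ (K + ε • w) ω - stochExp hμ K ω - ε * hμ.stochExpDeriv K w ω
      = stochExp hμ K ω *
        (Real.exp (ε * wienerIntegral hμ w ω - ε * inner ℝ K w - ε ^ 2 * ‖w‖ ^ 2 / 2) - 1
          - ε * (wienerIntegral hμ w ω - inner ℝ K w)) := by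
    rw [h7, stochExpDeriv]; ring
  rw [h8, norm_mul, Real.norm_of_nonneg (hμ.stochExp_pos K ω).le, Real.norm_eq_abs]
  calc _ ≤ Real.exp (wienerIntegral hμ K ω) * _ :=
        mul_le_mul (hμ.stochExp_le K ω) key (abs_nonneg _) (Real.exp_pos _).le
    _ = _ := by ring

/-- The constant is uniform over the unit ball because `|K ± 2w| ≤ |K| + 2`. This uniformity
upgrades directional to Fréchet differentiability. -/
theorem eLpNorm_stochExp_remainder_le (hμ : IsWienerMeasure T μ) {r : ℝ≥0∞} (hr1 : 1 ≤ r)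
    (hr : r ≠ ∞) (K : L2T T) :
    ∃ C : ℝ, 0 ≤ C ∧ ∀ w : L2T T, ‖w‖ ≤ 1 → ∀ ε : ℝ, 0 ≤ ε → ε ≤ 1 →
      eLpNorm (fun ω => stochExp hμ (K + ε • w) ω - stochExp hμ K ω
        - ε * hμ.stochExpDeriv K w ω) r μ ≤ ENNReal.ofReal (C * ε ^ 2) := by
  set A : ℝ := 3 * Real.exp (2 * (‖K‖ + 1))
  set M : ℝ := Real.exp (r.toReal * (‖K‖ + 2) ^ 2 / 2)
  refine ⟨A * (M + M), by positivity, fun w hw ε hε0 hε1 => ?_⟩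
  have hm (f : L2T T) :
      AEStronglyMeasurable (fun ω => Real.exp (wienerIntegral hμ f ω)) μ :=
    (hμ.measurable_wienerIntegral f).exp.aestronglyMeasurable
  have hK (a : ℝ) (ha : |a| = 2) : ‖K + a • w‖ ≤ ‖K‖ + 2 := by
    refine (norm_add_le _ _).trans ?_
    rw [norm_smul, Real.norm_eq_abs, ha]
    linarith
  calc _ ≤ eLpNorm ((ε ^ 2 * A) • ((fun ω => Real.exp (wienerIntegral hμ (K + (2 : ℝ) • w) ω))
          + fun ω => Real.exp (wienerIntegral hμ (K + (-2 : ℝ) • w) ω))) r μ := by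
        refine eLpNorm_mono_ae ?_
        filter_upwards [hμ.norm_stochExp_remainder_le K w hw hε0 hε1] with ω hω
        refine hω.trans (le_abs_self _)
    _ = ENNReal.ofReal (ε ^ 2 * A) * _ := by
        rw [eLpNorm_const_smul, Real.enorm_eq_ofReal (by positivity)]
    _ ≤ ENNReal.ofReal (ε ^ 2 * A) * (ENNReal.ofReal M + ENNReal.ofReal M) := by
        gcongr
        refine (eLpNorm_add_le (hm _) (hm _) hr1).trans (add_le_add ?_ ?_)
        · exact hμ.eLpNorm_exp_wienerIntegral_le hr1 hr (hK 2 (by norm_num))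
        · exact hμ.eLpNorm_exp_wienerIntegral_le hr1 hr (hK (-2) (by norm_num))
    _ = _ := by
        rw [← ENNReal.ofReal_add (by positivity) (by positivity), ← ENNReal.ofReal_mul (by positivity)]
        ring_nf

/-! ### The stochastic exponential as a Fréchet differentiable map into `L^r` -/

section Frechet

variable {r : ℝ≥0∞} [hr1 : Fact (1 ≤ r)]

/-- The stochastic exponential as an element of `L^r`. -/
def stochExpLp (hμ : IsWienerMeasure T μ) (hr : r ≠ ∞) (f : L2T T) : Lp ℝ r μ :=
  (hμ.memLp_stochExp f hr).toLp

/-- The derivative of the stochastic exponential as a linear map into `L^r`. -/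
def stochExpDerivLp (hμ : IsWienerMeasure T μ) (hr : r ≠ ∞) (K : L2T T) :
    L2T T →ₗ[ℝ] Lp ℝ r μ where
  toFun v := (hμ.memLp_stochExpDeriv K v hr).toLp
  map_add' v w := by
    rw [← MemLp.toLp_add, MemLp.toLp_eq_toLp_iff]
    filter_upwards [hμ.wienerIntegral_add v w] with ω hω
    simp only [stochExpDeriv, hω, inner_add_right, Pi.add_apply]
    ring
  map_smul' a v := by
    rw [RingHom.id_apply, ← MemLp.toLp_const_smul, MemLp.toLp_eq_toLp_iff]
    filter_upwards [hμ.wienerIntegral_smul a v] with ω hω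
    simp only [stochExpDeriv, hω, inner_smul_right, Pi.smul_apply, smul_eq_mul]
    ring

theorem norm_stochExpLp_remainder_le (hμ : IsWienerMeasure T μ) (hr : r ≠ ∞) (K : L2T T) :
    ∃ C : ℝ, 0 ≤ C ∧ ∀ w : L2T T, ‖w‖ ≤ 1 → ∀ ε : ℝ, 0 ≤ ε → ε ≤ 1 →
      ‖hμ.stochExpLp hr (K + ε • w) - hμ.stochExpLp hr K - ε • hμ.stochExpDerivLp hr K w‖
        ≤ C * ε ^ 2 := by
  obtain ⟨C, hC, h⟩ := hμ.eLpNorm_stochExp_remainder_le hr1.out hr K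
  refine ⟨C, hC, fun w hw ε hε0 hε1 => ?_⟩
  have h1 : hμ.stochExpLp hr (K + ε • w) - hμ.stochExpLp hr K - ε • hμ.stochExpDerivLp hr K w
      = (((hμ.memLp_stochExp (K + ε • w) hr).sub (hμ.memLp_stochExp K hr)).sub
        ((hμ.memLp_stochExpDeriv K w hr).const_smul ε)).toLp := by
    rw [MemLp.toLp_sub ((hμ.memLp_stochExp (K + ε • w) hr).sub (hμ.memLp_stochExp K hr))
      ((hμ.memLp_stochExpDeriv K w hr).const_smul ε),
      MemLp.toLp_sub (hμ.memLp_stochExp (K + ε • w) hr) (hμ.memLp_stochExp K hr),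
      MemLp.toLp_const_smul ε (hμ.memLp_stochExpDeriv K w hr)]
    rfl
  rw [h1, Lp.norm_toLp]
  exact ENNReal.toReal_le_of_le_ofReal (by positivity) (h w hw ε hε0 hε1)

theorem exists_smul_eq_norm_smul (v : L2T T) : ∃ w : L2T T, ‖w‖ ≤ 1 ∧ v = ‖v‖ • w := by
  rcases eq_or_ne v 0 with rfl | hv
  · exact ⟨0, by simp, by simp⟩
  · have hv' : ‖v‖ ≠ 0 := norm_ne_zero_iff.2 hv
    exact ⟨‖v‖⁻¹ • v, by rw [norm_smul, norm_inv, norm_norm, inv_mul_cancel₀ hv'],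
      by rw [smul_smul, mul_inv_cancel₀ hv', one_smul]⟩

theorem norm_stochExpLp_le (hμ : IsWienerMeasure T μ) (hr : r ≠ ∞) {f : L2T T} {M : ℝ}
    (hf : ‖f‖ ≤ M) : ‖hμ.stochExpLp hr f‖ ≤ Real.exp (r.toReal * M ^ 2 / 2) := by
  rw [stochExpLp, Lp.norm_toLp]
  refine ENNReal.toReal_le_of_le_ofReal (by positivity)
    (le_trans ?_ (hμ.eLpNorm_exp_wienerIntegral_le hr1.out hr hf))
  refine eLpNorm_mono fun ω => ?_
  rw [Real.norm_of_nonneg (hμ.stochExp_pos f ω).le, Real.norm_of_nonneg (Real.exp_pos _).le]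
  exact hμ.stochExp_le f ω

/-- The remainder estimate at `ε = 1` already bounds the derivative on the unit ball, as an
increment minus a remainder. -/
theorem exists_norm_stochExpDerivLp_le (hμ : IsWienerMeasure T μ) (hr : r ≠ ∞) (K : L2T T) :
    ∃ C : ℝ, ∀ v : L2T T, ‖hμ.stochExpDerivLp hr K v‖ ≤ C * ‖v‖ := by
  obtain ⟨C, hC, h⟩ := hμ.norm_stochExpLp_remainder_le hr K
  set M := Real.exp (r.toReal * (‖K‖ + 1) ^ 2 / 2)
  refine ⟨M + M + C, fun v => ?_⟩
  obtain ⟨w, hw, hv⟩ := exists_smul_eq_norm_smul v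
  have h1 := h w hw 1 zero_le_one le_rfl
  rw [one_smul, one_smul, one_pow, mul_one] at h1
  have h2 : ‖hμ.stochExpDerivLp hr K w‖ ≤ M + M + C := by
    have h3 : hμ.stochExpDerivLp hr K w = hμ.stochExpLp hr (K + w) - hμ.stochExpLp hr K
      - (hμ.stochExpLp hr (K + w) - hμ.stochExpLp hr K - hμ.stochExpDerivLp hr K w) := by abel
    rw [h3]
    refine (norm_sub_le _ _).trans (add_le_add ((norm_sub_le _ _).trans (add_le_add ?_ ?_)) h1)
    · exact hμ.norm_stochExpLp_le hr ((norm_add_le _ _).trans (by linarith))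
    · exact hμ.norm_stochExpLp_le hr (by linarith)
  conv_lhs => rw [hv]
  rw [map_smul, norm_smul, norm_norm, mul_comm]
  gcongr

/-- The derivative of the stochastic exponential as a continuous linear map into `L^r`. -/
def stochExpFDeriv (hμ : IsWienerMeasure T μ) (hr : r ≠ ∞) (K : L2T T) :
    L2T T →L[ℝ] Lp ℝ r μ :=
  (hμ.stochExpDerivLp hr K).mkContinuousOfExistsBound (hμ.exists_norm_stochExpDerivLp_le hr K)

theorem stochExpFDeriv_ae_eq (hμ : IsWienerMeasure T μ) (hr : r ≠ ∞) (K v : L2T T) :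
    hμ.stochExpFDeriv hr K v =ᵐ[μ] hμ.stochExpDeriv K v :=
  (hμ.memLp_stochExpDeriv K v hr).coeFn_toLp

/-- Writing `v = |v| w` and taking `ε = |v|` turns the uniform remainder estimate into `O(|v|²)`. -/
theorem hasFDerivAt_stochExpLp (hμ : IsWienerMeasure T μ) (hr : r ≠ ∞) (K : L2T T) :
    HasFDerivAt (hμ.stochExpLp hr) (hμ.stochExpFDeriv hr K) K := by
  obtain ⟨C, hC, h⟩ := hμ.norm_stochExpLp_remainder_le hr K
  rw [hasFDerivAt_iff_isLittleO_nhds_zero]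
  refine Asymptotics.IsBigO.trans_isLittleO (g := fun v : L2T T => ‖v‖ ^ 2) ?_
    (Asymptotics.isLittleO_norm_pow_id one_lt_two)
  refine Asymptotics.IsBigO.of_bound C ?_
  filter_upwards [Metric.closedBall_mem_nhds (0 : L2T T) one_pos] with v hv
  obtain ⟨w, hw, hvw⟩ := exists_smul_eq_norm_smul v
  have h1 := h w hw ‖v‖ (norm_nonneg _) (by simpa using hv)
  rw [← map_smul, ← hvw] at h1
  rw [norm_pow, norm_norm]
  exact h1

end Frechet

/-! ### The S-transform of translated random variables -/

theorem sTransform_congr (hμ : IsWienerMeasure T μ) {X Y : PathSpace T → ℝ} (h : X =ᵐ[μ] Y)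
    (f : L2T T) : sTransform hμ X f = sTransform hμ Y f :=
  integral_congr_ae (h.mul (EventuallyEq.refl _ _))

/-- Translating `𝓔(f)` as well costs the factor `exp(-⟨f, g⟩)`. Cameron-Martin then supplies `𝓔(g)`,
and `𝓔(f) 𝓔(g) exp(-⟨f, g⟩) = 𝓔(f + g)`. -/
theorem sTransform_comp_shift (hμ : IsWienerMeasure T μ) {X : PathSpace T → ℝ}
    (hX : AEStronglyMeasurable X μ) (f g : L2T T) :
    sTransform hμ (fun ω => X (shift g ω)) f = sTransform hμ X (f + g) := by
  have h1 : ∀ᵐ ω ∂μ, X (shift g ω) * stochExp hμ f ω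
      = Real.exp (-inner ℝ f g) * (X (shift g ω) * stochExp hμ f (shift g ω)) := by
    filter_upwards [hμ.stochExp_shift f g] with ω hω
    rw [hω, Real.exp_neg]
    field_simp
  rw [sTransform, integral_congr_ae h1, integral_const_mul,
    hμ.integral_comp_shift g (F := fun ω => X ω * stochExp hμ f ω)
      (hX.mul (hμ.measurable_stochExp f).aestronglyMeasurable), ← integral_const_mul]
  refine integral_congr_ae ?_
  filter_upwards [hμ.stochExp_add f g] with ω hω
  rw [hω]
  ring

theorem integral_wienerIntegral (hμ : IsWienerMeasure T μ) (v : L2T T) :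
    ∫ ω, wienerIntegral hμ v ω ∂μ = 0 := by
  have h := integral_id_gaussianReal (μ := 0) (v := ‖v‖₊ ^ 2)
  rw [← hμ.map_wienerIntegral v, integral_map (hμ.measurable_wienerIntegral v).aemeasurable
    (by fun_prop)] at h
  exact h

theorem sTransform_wienerIntegral (hμ : IsWienerMeasure T μ) (v f : L2T T) :
    sTransform hμ (wienerIntegral hμ v) f = inner ℝ v f := by
  have := hμ.isProbabilityMeasure
  rw [sTransform, ← hμ.integral_comp_shift f (Lp.aestronglyMeasurable _),
    integral_congr_ae (hμ.wienerIntegral_shift v f), integral_add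
      (memLp_one_iff_integrable.1 (hμ.memLp_wienerIntegral v ENNReal.one_ne_top))
      (integrable_const _), hμ.integral_wienerIntegral]
  simp

/-- The factor `δ(v)` is itself the translate by `g` of `δ(v) - ⟨v, g⟩`, so the whole product is a
translate. -/
theorem sTransform_comp_shift_mul_wienerIntegral (hμ : IsWienerMeasure T μ)
    {X : PathSpace T → ℝ} (hX : AEStronglyMeasurable X μ) (f g v : L2T T) :
    sTransform hμ (fun ω => X (shift g ω) * wienerIntegral hμ v ω) f
      = sTransform hμ (fun ω => X ω * (wienerIntegral hμ v ω - inner ℝ v g)) (f + g) := by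
  rw [← hμ.sTransform_comp_shift
    (X := fun ω => X ω * (wienerIntegral hμ v ω - inner ℝ v g))
    (hX.mul (hμ.memLp_wienerIntegral_sub_const v _ ENNReal.one_ne_top).1)]
  refine hμ.sTransform_congr ?_ f
  filter_upwards [hμ.wienerIntegral_shift v g] with ω hω
  simp [hω]

/-- The derivative of the S-transform of `u ↦ T_{h(u)} X_u`. -/
theorem hasDerivWithinAt_sTransform (hμ : IsWienerMeasure T μ) {p : ℝ≥0∞} [Fact (1 ≤ p)]
    (hp1 : 1 < p) {X : ℝ → Lp ℝ p μ} {X' : Lp ℝ p μ} {h : ℝ → L2T T} {h' : L2T T} {s : Set ℝ}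
    {t : ℝ} (hX : HasDerivWithinAt X X' s t) (hh : HasDerivWithinAt h h' s t) (f : L2T T) :
    HasDerivWithinAt (fun u => sTransform hμ (pathShift (h u) (X u)) f)
      (sTransform hμ (pathShift (h t) X') f
        + sTransform hμ (fun ω => pathShift (h t) (X t) ω * wienerIntegral hμ h' ω) f
        - sTransform hμ (pathShift (h t) (X t)) f * sTransform hμ (wienerIntegral hμ h') f)
      s t := by
  have hpr : ENNReal.HolderConjugate p (ENNReal.conjExponent p) := inferInstance
  set r := ENNReal.conjExponent p with hr_def
  have hr : r ≠ ∞ := conjExponent_ne_top hp1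
  have : Fact (1 ≤ r) := ⟨by rw [hr_def, ENNReal.conjExponent]; exact le_self_add⟩
  let P := (ContinuousLinearMap.mul ℝ ℝ).lpPairing μ p r
  have hP (Y : Lp ℝ p μ) (g k : L2T T) :
      sTransform hμ (pathShift g Y) k = P Y (hμ.stochExpLp hr (k + g)) := by
    rw [ContinuousLinearMap.lpPairing_eq_integral]
    refine (hμ.sTransform_comp_shift (Lp.aestronglyMeasurable Y) k g).trans (integral_congr_ae ?_)
    filter_upwards [(hμ.memLp_stochExp (k + g) hr).coeFn_toLp] with ω hω
    rw [stochExpLp, hω, ContinuousLinearMap.mul_apply']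
  have h1 : HasDerivWithinAt (fun u => hμ.stochExpLp hr (f + h u))
      (hμ.stochExpFDeriv hr (f + h t) h') s t :=
    HasFDerivAt.comp_hasDerivWithinAt (f := fun u => f + h u) t
      (hμ.hasFDerivAt_stochExpLp hr (f + h t)) (hh.const_add f)
  have h2 := P.hasDerivWithinAt_of_bilinear hX h1
  simp_rw [hP]
  refine h2.congr_deriv ?_
  -- The derivative of the exponential carries `δ(h') - ⟨f + h, h'⟩`, the ordinary product only
  -- `δ(h') - ⟨h, h'⟩`; the discrepancy `⟨f, h'⟩` is the Wick term.
  have h3 : sTransform hμ (fun ω => pathShift (h t) (X t) ω * wienerIntegral hμ h' ω) f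
      = P (X t) (hμ.stochExpFDeriv hr (f + h t) h')
        + inner ℝ f h' * P (X t) (hμ.stochExpLp hr (f + h t)) := by
    refine (hμ.sTransform_comp_shift_mul_wienerIntegral (Lp.aestronglyMeasurable (X t)) f (h t)
      h').trans ?_
    rw [ContinuousLinearMap.lpPairing_eq_integral, ContinuousLinearMap.lpPairing_eq_integral,
      ← integral_const_mul, ← integral_add]
    · refine integral_congr_ae ?_
      filter_upwards [hμ.stochExpFDeriv_ae_eq hr (f + h t) h',
        (hμ.memLp_stochExp (f + h t) hr).coeFn_toLp] with ω h4 h5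
      rw [h4, stochExpLp, h5, ContinuousLinearMap.mul_apply', ContinuousLinearMap.mul_apply',
        stochExpDeriv, inner_add_left, real_inner_comm (h t) h']
      ring
    · exact (Lp.memLp (X t)).integrable_mul (Lp.memLp _)
    · exact ((Lp.memLp (X t)).integrable_mul (Lp.memLp _)).const_mul _
  rw [h3, hμ.sTransform_wienerIntegral, real_inner_comm]
  ring

end IsWienerMeasure

/-! ### Continuity of the S-transform and the Wick product as a derivative -/

theorem memLp_mul_of_lt {F G : PathSpace T → ℝ} {p q : ℝ≥0∞} (hqp : q < p)
    (hF : MemLp F p μ) (hG : ∀ r : ℝ≥0∞, r ≠ ∞ → MemLp G r μ) :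
    MemLp (fun ω => F ω * G ω) q μ := by
  have hlt : p⁻¹ < q⁻¹ := ENNReal.inv_lt_inv.2 hqp
  have : ENNReal.HolderTriple p (q⁻¹ - p⁻¹)⁻¹ q :=
    ⟨by rw [inv_inv, add_comm, tsub_add_cancel_of_le hlt.le]⟩
  exact (hG _ (ENNReal.inv_ne_top.2 (tsub_pos_of_lt hlt).ne')).mul' hF

namespace IsWienerMeasure

theorem memLp_pathShift (hμ : IsWienerMeasure T μ) {p q : ℝ≥0∞} (hp : 1 < p) (hqp : q < p)
    (g : L2T T) {X : PathSpace T → ℝ} (hX : MemLp X p μ) : MemLp (pathShift g X) q μ := by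
  have := hμ.isProbabilityMeasure
  -- The translation bound is for exponents at least `1`; smaller `q` follow on a probability space.
  exact (hμ.memLp_comp_shift (le_max_right q 1) (max_lt hqp hp) g hX).mono_exponent
    (le_max_left q 1)

theorem memLp_pathShift_mul_wienerIntegral (hμ : IsWienerMeasure T μ) {p q : ℝ≥0∞} (hp : 1 < p)
    (hqp : q < p) (g v : L2T T) {X : PathSpace T → ℝ} (hX : MemLp X p μ) :
    MemLp (fun ω => pathShift g X ω * wienerIntegral hμ v ω) q μ := by
  obtain ⟨r, hqr, hrp⟩ := exists_between hqp
  exact memLp_mul_of_lt hqr (hμ.memLp_pathShift hp hrp g hX) fun _ h => hμ.memLp_wienerIntegral v h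

theorem integrable_mul_stochExp (hμ : IsWienerMeasure T μ) {q : ℝ≥0∞} (hq : 1 < q)
    {X : PathSpace T → ℝ} (hX : MemLp X q μ) (f : L2T T) :
    Integrable (fun ω => X ω * stochExp hμ f ω) μ := by
  have := ENNReal.HolderConjugate.conjExponent hq.le
  exact hX.integrable_mul (hμ.memLp_stochExp f (conjExponent_ne_top hq))

theorem sTransform_add (hμ : IsWienerMeasure T μ) {q : ℝ≥0∞} (hq : 1 < q)
    {X Y : PathSpace T → ℝ} (hX : MemLp X q μ) (hY : MemLp Y q μ) (f : L2T T) :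
    sTransform hμ (fun ω => X ω + Y ω) f = sTransform hμ X f + sTransform hμ Y f := by
  simp only [sTransform, add_mul]
  exact integral_add (hμ.integrable_mul_stochExp hq hX f) (hμ.integrable_mul_stochExp hq hY f)

theorem sTransform_sub (hμ : IsWienerMeasure T μ) {q : ℝ≥0∞} (hq : 1 < q)
    {X Y : PathSpace T → ℝ} (hX : MemLp X q μ) (hY : MemLp Y q μ) (f : L2T T) :
    sTransform hμ (fun ω => X ω - Y ω) f = sTransform hμ X f - sTransform hμ Y f := by
  simp only [sTransform, sub_mul]
  exact integral_sub (hμ.integrable_mul_stochExp hq hX f) (hμ.integrable_mul_stochExp hq hY f)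

theorem sTransform_const_mul (hμ : IsWienerMeasure T μ) (a : ℝ) (X : PathSpace T → ℝ)
    (f : L2T T) : sTransform hμ (fun ω => a * X ω) f = a * sTransform hμ X f := by
  simp only [sTransform, mul_assoc]
  exact integral_const_mul _ _

/-- Hölder's inequality; as `𝓔(f)` has all finite moments, the S-transform at `f` is continuous on
`L^q`. -/
theorem enorm_sTransform_le (hμ : IsWienerMeasure T μ) {q : ℝ≥0∞} (hq : 1 < q)
    {X : PathSpace T → ℝ} (hX : AEStronglyMeasurable X μ) (f : L2T T) :
    ‖sTransform hμ X f‖ₑ ≤ eLpNorm X q μ * eLpNorm (stochExp hμ f) (ENNReal.conjExponent q) μ := by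
  have := ENNReal.HolderConjugate.conjExponent hq.le
  have h := eLpNorm_smul_le_mul_eLpNorm (p := q) (q := ENNReal.conjExponent q) (r := 1)
    (hμ.measurable_stochExp f).aestronglyMeasurable hX
  rw [eLpNorm_one_eq_lintegral_enorm] at h
  rw [sTransform]
  exact (enorm_integral_le_lintegral_enorm _).trans h

theorem tendsto_sTransform (hμ : IsWienerMeasure T μ) {q : ℝ≥0∞} (hq : 1 < q) {ι : Type*}
    {l : Filter ι} {W : ι → PathSpace T → ℝ} {A : PathSpace T → ℝ} (hW : ∀ i, MemLp (W i) q μ)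
    (hA : MemLp A q μ) (h : Tendsto (fun i => eLpNorm (fun ω => W i ω - A ω) q μ) l (𝓝 0))
    (f : L2T T) : Tendsto (fun i => sTransform hμ (W i) f) l (𝓝 (sTransform hμ A f)) := by
  rw [tendsto_iff_edist_tendsto_0]
  have h1 := ENNReal.Tendsto.mul_const (b := eLpNorm (stochExp hμ f) (ENNReal.conjExponent q) μ) h
    (Or.inr (hμ.memLp_stochExp f (conjExponent_ne_top hq)).2.ne)
  rw [zero_mul] at h1
  refine tendsto_of_tendsto_of_tendsto_of_le_of_le tendsto_const_nhds h1 (fun _ => zero_le)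
    fun i => ?_
  rw [edist_eq_enorm_sub, ← hμ.sTransform_sub hq (hW i) hA]
  exact hμ.enorm_sTransform_le hq ((hW i).sub hA).1 f

/-- The S-transform of the difference quotient is the slope of the S-transform. Its two limits agree
because `t` is an accumulation point of `s`. -/
theorem sTransform_eq_of_hasLqDerivWithinAt (hμ : IsWienerMeasure T μ) {q : ℝ≥0∞} (hq : 1 < q)
    {Y : ℝ → PathSpace T → ℝ} {A : PathSpace T → ℝ} {s : Set ℝ} {t : ℝ}
    (hY : ∀ u, MemLp (Y u) q μ) (h : HasLqDerivWithinAt μ q Y A s t)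
    (hs : UniqueDiffWithinAt ℝ s t) {f : L2T T} {d : ℝ}
    (hd : HasDerivWithinAt (fun u => sTransform hμ (Y u) f) d s t) :
    sTransform hμ A f = d := by
  have h1 := hμ.tendsto_sTransform hq
    (fun u => ((hY u).sub (hY t)).const_mul (u - t)⁻¹) h.1 h.2 f
  have h2 := hasDerivWithinAt_iff_tendsto_slope.1 hd
  have : (𝓝[s \ {t}] t).NeBot := by
    rw [← accPt_principal_iff_nhdsWithin]
    exact hs.accPt
  refine tendsto_nhds_unique h1 (h2.congr fun u => ?_)
  have h3 : sTransform hμ (fun ω => (u - t)⁻¹ * (Y u - Y t) ω) f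
      = (u - t)⁻¹ * sTransform hμ (fun ω => Y u ω - Y t ω) f :=
    hμ.sTransform_const_mul _ (Y u - Y t) f
  rw [h3, hμ.sTransform_sub hq (hY u) (hY t)]
  simp [slope_def_field, div_eq_inv_mul]

theorem hasLqDerivWithinAt_mono_exponent (hμ : IsWienerMeasure T μ) {q r : ℝ≥0∞} (hrq : r ≤ q)
    {Y : ℝ → PathSpace T → ℝ} {A : PathSpace T → ℝ} {s : Set ℝ} {t : ℝ}
    (hY : ∀ u, AEStronglyMeasurable (Y u) μ) (h : HasLqDerivWithinAt μ q Y A s t) :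
    HasLqDerivWithinAt μ r Y A s t := by
  have := hμ.isProbabilityMeasure
  refine ⟨h.1.mono_exponent hrq, ?_⟩
  refine tendsto_of_tendsto_of_tendsto_of_le_of_le tendsto_const_nhds h.2 (fun _ => zero_le)
    fun u => ?_
  exact eLpNorm_le_eLpNorm_of_exponent_le hrq
    ((((hY u).sub (hY t)).const_mul (u - t)⁻¹).sub h.1.1)

/-- If `u ↦ T_{h(u)} X_u` is differentiable at `t` in some `𝓛^q`, `q > 1`, then the Wick product of
`T_{h(t)} X_t` and `δ(h'(t))` exists. -/
theorem isWickProduct_of_hasLqDerivWithinAt (hμ : IsWienerMeasure T μ) {p : ℝ≥0∞} [Fact (1 ≤ p)]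
    (hp1 : 1 < p) {X : ℝ → Lp ℝ p μ} {X' : Lp ℝ p μ} {h : ℝ → L2T T} {h' : L2T T} {s : Set ℝ}
    {t : ℝ} (hX : HasDerivWithinAt X X' s t) (hh : HasDerivWithinAt h h' s t)
    (hs : UniqueDiffWithinAt ℝ s t) {q : ℝ≥0∞} (hq : 1 < q) {A : PathSpace T → ℝ}
    (hA : HasLqDerivWithinAt μ q (fun u => pathShift (h u) (X u)) A s t) :
    IsWickProduct hμ (pathShift (h t) (X t)) (wienerIntegral hμ h')
      (fun ω => pathShift (h t) X' ω + pathShift (h t) (X t) ω * wienerIntegral hμ h' ω - A ω) := by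
  -- A common exponent for `A` and the translated terms, still above `1` so that S-transforms are
  -- additive and continuous.
  obtain ⟨r, hr1, hrmin⟩ := exists_between (lt_min hq hp1)
  have hrq : r < q := hrmin.trans_le (min_le_left _ _)
  have hrp : r < p := hrmin.trans_le (min_le_right _ _)
  have hY (u : ℝ) : MemLp (pathShift (h u) (X u)) r μ :=
    hμ.memLp_pathShift hp1 hrp (h u) (Lp.memLp (X u))
  have hA' := hμ.hasLqDerivWithinAt_mono_exponent hrq.le (fun u => (hY u).1) hA
  have hX' : MemLp (pathShift (h t) X') r μ := hμ.memLp_pathShift hp1 hrp (h t) (Lp.memLp X')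
  have hXδ : MemLp (fun ω => pathShift (h t) (X t) ω * wienerIntegral hμ h' ω) r μ :=
    hμ.memLp_pathShift_mul_wienerIntegral hp1 hrp (h t) h' (Lp.memLp (X t))
  refine ⟨⟨r, hr1, hY t⟩, ⟨2, by norm_num, Lp.memLp _⟩, ⟨r, hr1, (hX'.add hXδ).sub hA'.1⟩,
    fun f => ?_⟩
  have h1 := hμ.sTransform_eq_of_hasLqDerivWithinAt hr1 hY hA' hs
    (hμ.hasDerivWithinAt_sTransform hp1 hX hh f)
  have h2 := hμ.sTransform_sub (X := fun ω => pathShift (h t) X' ω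
    + pathShift (h t) (X t) ω * wienerIntegral hμ h' ω) hr1 (hX'.add hXδ) hA'.1 f
  have h3 := hμ.sTransform_add hr1 hX' hXδ f
  rw [h2, h3, h1]
  ring

end IsWienerMeasure

/-! ### Differentiability of translations on the Malliavin-Sobolev space -/

namespace IsWienerMeasure

theorem memLp_expComb (hμ : IsWienerMeasure T μ) (c : L2T T →₀ ℝ) {r : ℝ≥0∞} (hr : r ≠ ∞) :
    MemLp (expComb hμ c) r μ :=
  memLp_finsetSum _ fun f _ => (hμ.memLp_stochExp f hr).const_mul (c f)

theorem memLp_expCombDeriv (hμ : IsWienerMeasure T μ) (c : L2T T →₀ ℝ) {r : ℝ≥0∞} (hr : r ≠ ∞) :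
    MemLp (expCombDeriv hμ c) r μ :=
  memLp_finsetSum _ fun f _ => (ContinuousLinearMap.toSpanSingleton ℝ f).comp_memLp'
    ((hμ.memLp_stochExp f hr).const_mul (c f))

theorem stochExp_shift_forall (hμ : IsWienerMeasure T μ) (c : L2T T →₀ ℝ) (g : L2T T) :
    ∀ᵐ ω ∂μ, ∀ f ∈ c.support,
      stochExp hμ f (shift g ω) = Real.exp (inner ℝ f g) * stochExp hμ f ω :=
  (Filter.eventually_all_finset _).2 fun f _ => hμ.stochExp_shift f g

/-- Only the scalar coefficients depend on `g`, so differentiating in `g` stays in a fixed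
finite-dimensional span. -/
theorem expComb_shift (hμ : IsWienerMeasure T μ) (c : L2T T →₀ ℝ) (g : L2T T) :
    ∀ᵐ ω ∂μ, expComb hμ c (shift g ω)
      = ∑ f ∈ c.support, c f * Real.exp (inner ℝ f g) * stochExp hμ f ω := by
  filter_upwards [hμ.stochExp_shift_forall c g] with ω hω
  refine Finset.sum_congr rfl fun f hf => ?_
  dsimp only
  rw [hω f hf, mul_assoc]

theorem inner_expCombDeriv_shift (hμ : IsWienerMeasure T μ) (c : L2T T →₀ ℝ) (g v : L2T T) :
    ∀ᵐ ω ∂μ, inner ℝ (expCombDeriv hμ c (shift g ω)) v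
      = ∑ f ∈ c.support, c f * (Real.exp (inner ℝ f g) * inner ℝ f v) * stochExp hμ f ω := by
  filter_upwards [hμ.stochExp_shift_forall c g] with ω hω
  rw [expCombDeriv, Finsupp.sum, sum_inner]
  refine Finset.sum_congr rfl fun f hf => ?_
  rw [hω f hf, inner_smul_left, conj_trivial]
  ring

theorem sum_smul_stochExpLp_ae_eq (hμ : IsWienerMeasure T μ) {q : ℝ≥0∞} [Fact (1 ≤ q)]
    (hq : q ≠ ∞) (s : Finset (L2T T)) (b : L2T T → ℝ) :
    ∀ᵐ ω ∂μ, (∑ f ∈ s, b f • hμ.stochExpLp hq f : Lp ℝ q μ) ω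
      = ∑ f ∈ s, b f * stochExp hμ f ω := by
  have h1 : ∀ᵐ ω ∂μ, ∀ f ∈ s, (b f • hμ.stochExpLp hq f : Lp ℝ q μ) ω = b f * stochExp hμ f ω := by
    refine (Filter.eventually_all_finset _).2 fun f _ => ?_
    filter_upwards [Lp.coeFn_smul (b f) (hμ.stochExpLp hq f), (hμ.memLp_stochExp f hq).coeFn_toLp]
      with ω h2 h3
    rw [h2, Pi.smul_apply, stochExpLp, h3, smul_eq_mul]
  filter_upwards [h1, Lp.coeFn_finsetSum s fun f => b f • hμ.stochExpLp hq f] with ω h2 h3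
  rw [h3, Finset.sum_apply]
  exact Finset.sum_congr rfl h2

/-- The first order remainder `T_{g+v} X - T_g X - T_g ⟨DX, v⟩`. -/
def shiftRemainder (X : PathSpace T → ℝ) (DX : PathSpace T → L2T T) (g v : L2T T)
    (ω : PathSpace T) : ℝ :=
  X (shift (g + v) ω) - X (shift g ω) - inner ℝ (DX (shift g ω)) v

/-- The mean value inequality for translations of linear combinations of stochastic
exponentials. -/
theorem eLpNorm_shiftRemainder_expComb_le (hμ : IsWienerMeasure T μ) {q : ℝ≥0∞} (hq1 : 1 ≤ q)
    (hq : q ≠ ∞) (c : L2T T →₀ ℝ) (g v : L2T T) {B : ℝ≥0∞} (hB : B ≠ ∞)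
    (h : ∀ s ∈ Set.Icc (0 : ℝ) 1, eLpNorm (fun ω => expCombDeriv hμ c (shift (g + s • v) ω)
      - expCombDeriv hμ c (shift g ω)) q μ ≤ B) :
    eLpNorm (shiftRemainder (expComb hμ c) (expCombDeriv hμ c) g v) q μ ≤ B * ‖v‖ₑ := by
  have : Fact (1 ≤ q) := ⟨hq1⟩
  let e : ℝ → L2T T → ℝ := fun s f => c f * Real.exp (inner ℝ f (g + s • v))
  let d : ℝ → L2T T → ℝ := fun s f => c f * (Real.exp (inner ℝ f (g + s • v)) * inner ℝ f v)
  let S : (L2T T → ℝ) → Lp ℝ q μ := fun b => ∑ f ∈ c.support, b f • hμ.stochExpLp hq f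
  -- Subtracting the tangent at `s = 0` makes `Φ 1 - Φ 0` the remainder, and makes `Φ'` the
  -- oscillation of the derivative paired with `v`.
  let Φ : ℝ → Lp ℝ q μ := fun s => S (e s) - s • S (d 0)
  have hΦ (s : ℝ) : HasDerivAt Φ (S (d s) - S (d 0)) s := by
    have h1 : HasDerivAt (fun s => S (e s)) (S (d s)) s := by
      refine HasDerivAt.fun_sum fun f _ => HasDerivAt.smul_const ?_ _
      have h2 : HasDerivAt (fun s : ℝ => inner ℝ f (g + s • v)) (inner ℝ f v) s := by
        simp only [inner_add_right, inner_smul_right]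
        simpa using ((hasDerivAt_id s).mul_const (inner ℝ f v)).const_add (inner ℝ f g)
      exact h2.exp.const_mul _
    have h2 := (hasDerivAt_id s).smul_const (S (d 0))
    rw [one_smul] at h2
    exact h1.sub h2
  have hbound : ∀ s ∈ Set.Ico (0 : ℝ) 1, ‖S (d s) - S (d 0)‖ ≤ (B * ‖v‖ₑ).toReal := by
    intro s hs
    rw [Lp.norm_def]
    refine ENNReal.toReal_mono (ENNReal.mul_ne_top hB enorm_ne_top) ?_
    have h1 : eLpNorm (S (d s) - S (d 0) : Lp ℝ q μ) q μ ≤ ‖v‖ₑ * eLpNorm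
        (fun ω => expCombDeriv hμ c (shift (g + s • v) ω) - expCombDeriv hμ c (shift g ω)) q μ := by
      rw [← ofReal_norm, ← Real.coe_toNNReal _ (norm_nonneg v), ENNReal.ofReal_coe_nnreal]
      refine eLpNorm_le_nnreal_smul_eLpNorm_of_ae_le_mul ?_ q
      filter_upwards [Lp.coeFn_sub (S (d s)) (S (d 0)),
        hμ.sum_smul_stochExpLp_ae_eq hq c.support (d s),
        hμ.sum_smul_stochExpLp_ae_eq hq c.support (d 0),
        hμ.inner_expCombDeriv_shift c (g + s • v) v, hμ.inner_expCombDeriv_shift c g v]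
        with ω h1 h2 h3 h4 h5
      have h6 : d 0 = fun f => c f * (Real.exp (inner ℝ f g) * inner ℝ f v) := by
        simp only [d, zero_smul, add_zero]
      rw [h1, Pi.sub_apply, h2, h3, h6, ← h4, ← h5, ← inner_sub_left, mul_comm]
      have h7 := nnnorm_inner_le_nnnorm (𝕜 := ℝ) (expCombDeriv hμ c (shift (g + s • v) ω)
        - expCombDeriv hμ c (shift g ω)) v
      rwa [norm_toNNReal]
    rw [mul_comm]
    exact h1.trans (by gcongr; exact h s ⟨hs.1, hs.2.le⟩)
  have key := norm_image_sub_le_of_norm_deriv_le_segment_01'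
    (fun s _ => (hΦ s).hasDerivWithinAt) hbound
  have h1 : eLpNorm (shiftRemainder (expComb hμ c) (expCombDeriv hμ c) g v) q μ
      = eLpNorm (Φ 1 - Φ 0 : Lp ℝ q μ) q μ := by
    have h2 : Φ 1 - Φ 0 = S (e 1) - S (e 0) - S (d 0) := by
      simp only [Φ, one_smul, zero_smul, sub_zero]
      abel
    rw [h2]
    refine eLpNorm_congr_ae ?_
    filter_upwards [Lp.coeFn_sub (S (e 1) - S (e 0)) (S (d 0)), Lp.coeFn_sub (S (e 1)) (S (e 0)),
      hμ.sum_smul_stochExpLp_ae_eq hq c.support (e 1),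
      hμ.sum_smul_stochExpLp_ae_eq hq c.support (e 0),
      hμ.sum_smul_stochExpLp_ae_eq hq c.support (d 0),
      hμ.expComb_shift c (g + v), hμ.expComb_shift c g, hμ.inner_expCombDeriv_shift c g v]
      with ω h3 h4 h5 h6 h7 h8 h9 h10
    rw [shiftRemainder, h8, h9, h10, h3, Pi.sub_apply, h4, Pi.sub_apply, h5, h6, h7]
    simp only [e, d, one_smul, zero_smul, add_zero]
  rw [h1, ← Lp.enorm_def, ← ofReal_norm]
  exact (ENNReal.ofReal_le_ofReal key).trans
    (ENNReal.ofReal_toReal (ENNReal.mul_ne_top hB enorm_ne_top)).le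

theorem eLpNorm_inner_le (F : PathSpace T → L2T T) (v : L2T T) (q : ℝ≥0∞) :
    eLpNorm (fun ω => inner ℝ (F ω) v) q μ ≤ ‖v‖ₑ * eLpNorm F q μ := by
  rw [← ofReal_norm, ← Real.coe_toNNReal _ (norm_nonneg v), ENNReal.ofReal_coe_nnreal, norm_toNNReal]
  refine eLpNorm_le_nnreal_smul_eLpNorm_of_ae_le_mul (ae_of_all _ fun ω => ?_) q
  rw [mul_comm]
  exact nnnorm_inner_le_nnnorm _ _

/-- The mean value inequality for translations on the Malliavin-Sobolev space. -/
theorem eLpNorm_shiftRemainder_le (hμ : IsWienerMeasure T μ) {p q : ℝ≥0∞} (hq1 : 1 ≤ q)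
    (hqp : q < p) (hp : p ≠ ∞) {X : PathSpace T → ℝ} {DX : PathSpace T → L2T T}
    {c : ℕ → L2T T →₀ ℝ} (hX : MemLp X p μ) (hDX : MemLp DX p μ)
    (hc : Tendsto (fun n => eLpNorm (fun ω => expComb hμ (c n) ω - X ω) p μ) atTop (𝓝 0))
    (hcD : Tendsto (fun n => eLpNorm (fun ω => expCombDeriv hμ (c n) ω - DX ω) p μ) atTop (𝓝 0))
    (g v : L2T T) {B : ℝ≥0∞} (hB : B ≠ ∞)
    (h : ∀ s ∈ Set.Icc (0 : ℝ) 1,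
      eLpNorm (fun ω => DX (shift (g + s • v) ω) - DX (shift g ω)) q μ ≤ B) :
    eLpNorm (shiftRemainder X DX g v) q μ ≤ B * ‖v‖ₑ := by
  set C := shiftBound p q (‖g‖ + ‖v‖)
  have hC : C ≠ ∞ := shiftBound_ne_top _ _ _
  have hqt : q ≠ ∞ := (hqp.trans_le le_top).ne
  set x : ℕ → ℝ≥0∞ := fun n => eLpNorm (fun ω => expComb hμ (c n) ω - X ω) p μ
  set y : ℕ → ℝ≥0∞ := fun n => eLpNorm (fun ω => expCombDeriv hμ (c n) ω - DX ω) p μ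
  have hFm (n : ℕ) : MemLp (fun ω => expComb hμ (c n) ω - X ω) p μ :=
    (hμ.memLp_expComb (c n) hp).sub hX
  have hGm (n : ℕ) : MemLp (fun ω => expCombDeriv hμ (c n) ω - DX ω) p μ :=
    (hμ.memLp_expCombDeriv (c n) hp).sub hDX
  have hg : ‖g‖ ≤ ‖g‖ + ‖v‖ := le_add_of_nonneg_right (norm_nonneg v)
  have hgs (s : ℝ) (hs : s ∈ Set.Icc (0 : ℝ) 1) : ‖g + s • v‖ ≤ ‖g‖ + ‖v‖ := by
    refine (norm_add_le _ _).trans ?_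
    rw [norm_smul, Real.norm_of_nonneg hs.1]
    gcongr
    exact mul_le_of_le_one_left (norm_nonneg _) hs.2
  have hgv : ‖g + v‖ ≤ ‖g‖ + ‖v‖ := norm_add_le _ _
  -- Replacing `X` and `DX` by the `n`-th approximation costs multiples of `x n` and `y n`, with one
  -- constant for the whole segment; the limit leaves `B * ‖v‖ₑ`.
  have hn (n : ℕ) : eLpNorm (shiftRemainder X DX g v) q μ
      ≤ (B + (C * y n + C * y n)) * ‖v‖ₑ + (C * x n + C * x n + ‖v‖ₑ * (C * y n)) := by
    have hxn {k : L2T T} (hk : ‖k‖ ≤ ‖g‖ + ‖v‖) :=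
      hμ.eLpNorm_comp_shift_le hq1 hqp hk (hFm n).1
    have hyn {k : L2T T} (hk : ‖k‖ ≤ ‖g‖ + ‖v‖) :=
      hμ.eLpNorm_comp_shift_le hq1 hqp hk (hGm n).1
    have mF (k : L2T T) := hμ.aestronglyMeasurable_comp_shift k (hFm n).1
    have mG (k : L2T T) := hμ.aestronglyMeasurable_comp_shift k (hGm n).1
    have mD (k : L2T T) := hμ.aestronglyMeasurable_comp_shift k hDX.1
    have mI : AEStronglyMeasurable (fun ω => inner ℝ (expCombDeriv hμ (c n) (shift g ω)
        - DX (shift g ω)) v) μ := (mG g).inner aestronglyMeasurable_const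
    have mE (k : L2T T) := hμ.aestronglyMeasurable_comp_shift k (hμ.memLp_expComb (c n) hp).1
    have mED (k : L2T T) :=
      hμ.aestronglyMeasurable_comp_shift k (hμ.memLp_expCombDeriv (c n) hp).1
    have mR : AEStronglyMeasurable
        (shiftRemainder (expComb hμ (c n)) (expCombDeriv hμ (c n)) g v) μ :=
      ((mE (g + v)).sub (mE g)).sub ((mED g).inner aestronglyMeasurable_const)
    have hRn : eLpNorm (shiftRemainder (expComb hμ (c n)) (expCombDeriv hμ (c n)) g v) q μ
        ≤ (B + (C * y n + C * y n)) * ‖v‖ₑ := by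
      refine hμ.eLpNorm_shiftRemainder_expComb_le hq1 hqt (c n) g v ?_ fun s hs => ?_
      · have hy : C * y n ≠ ∞ := ENNReal.mul_ne_top hC (hGm n).2.ne
        exact ENNReal.add_ne_top.2 ⟨hB, ENNReal.add_ne_top.2 ⟨hy, hy⟩⟩
      · have hs1 : (fun ω => expCombDeriv hμ (c n) (shift (g + s • v) ω)
            - expCombDeriv hμ (c n) (shift g ω))
            = (fun ω => DX (shift (g + s • v) ω) - DX (shift g ω))
              + ((fun ω => expCombDeriv hμ (c n) (shift (g + s • v) ω) - DX (shift (g + s • v) ω))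
              - (fun ω => expCombDeriv hμ (c n) (shift g ω) - DX (shift g ω))) := by
          ext1 ω
          simp only [Pi.add_apply, Pi.sub_apply]
          abel
        rw [hs1]
        refine (eLpNorm_add_le ((mD _).sub (mD g)) ((mG _).sub (mG g)) hq1).trans
          (add_le_add (h s hs) ((eLpNorm_sub_le (mG _) (mG g) hq1).trans ?_))
        exact add_le_add (hyn (hgs s hs)) (hyn hg)
    have hsplit : shiftRemainder X DX g v
        = shiftRemainder (expComb hμ (c n)) (expCombDeriv hμ (c n)) g v
          + (((fun ω => expComb hμ (c n) (shift g ω) - X (shift g ω))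
            - (fun ω => expComb hμ (c n) (shift (g + v) ω) - X (shift (g + v) ω)))
            + fun ω => inner ℝ (expCombDeriv hμ (c n) (shift g ω) - DX (shift g ω)) v) := by
      ext1 ω
      simp only [shiftRemainder, Pi.add_apply, Pi.sub_apply, inner_sub_left]
      ring
    rw [hsplit]
    refine (eLpNorm_add_le mR (((mF g).sub (mF _)).add mI) hq1).trans (add_le_add hRn ?_)
    refine (eLpNorm_add_le ((mF g).sub (mF _)) mI hq1).trans (add_le_add ?_ ?_)
    · exact (eLpNorm_sub_le (mF g) (mF _) hq1).trans (add_le_add (hxn hg) (hxn hgv))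
    · refine (eLpNorm_inner_le _ v q).trans ?_
      gcongr
      exact hyn hg
  have hCx : Tendsto (fun n => C * x n) atTop (𝓝 0) := by
    simpa using ENNReal.Tendsto.const_mul hc (Or.inr hC)
  have hCy : Tendsto (fun n => C * y n) atTop (𝓝 0) := by
    simpa using ENNReal.Tendsto.const_mul hcD (Or.inr hC)
  have hlim : Tendsto (fun n => (B + (C * y n + C * y n)) * ‖v‖ₑ
      + (C * x n + C * x n + ‖v‖ₑ * (C * y n))) atTop
      (𝓝 ((B + (0 + 0)) * ‖v‖ₑ + (0 + 0 + ‖v‖ₑ * 0))) := by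
    refine Tendsto.add (ENNReal.Tendsto.mul_const (tendsto_const_nhds.add (hCy.add hCy))
      (Or.inr enorm_ne_top)) ((hCx.add hCx).add ?_)
    exact ENNReal.Tendsto.const_mul hCy (Or.inr enorm_ne_top)
  simp only [add_zero, mul_zero] at hlim
  exact ge_of_tendsto' hlim hn

theorem tendsto_eLpNorm_slope_sub {p : ℝ≥0∞} [Fact (1 ≤ p)] {X : ℝ → Lp ℝ p μ} {X' : Lp ℝ p μ}
    {s : Set ℝ} {t : ℝ} (hX : HasDerivWithinAt X X' s t) :
    Tendsto (fun u => eLpNorm (fun ω => (u - t)⁻¹ * (X u ω - X t ω) - X' ω) p μ)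
      (𝓝[s \ {t}] t) (𝓝 0) := by
  have h1 := tendsto_iff_edist_tendsto_0.1 (hasDerivWithinAt_iff_tendsto_slope.1 hX)
  refine h1.congr fun u => ?_
  rw [edist_eq_enorm_sub, Lp.enorm_def, slope, vsub_eq_sub]
  refine eLpNorm_congr_ae ?_
  filter_upwards [Lp.coeFn_sub ((u - t)⁻¹ • (X u - X t)) X', Lp.coeFn_sub (X u) (X t),
    Lp.coeFn_smul (u - t)⁻¹ (X u - X t)] with ω h2 h3 h4
  rw [h2, Pi.sub_apply, h4, Pi.smul_apply, h3, Pi.sub_apply, smul_eq_mul]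

/-- Take the increment `v = h(u) - h(t)` in the mean value inequality. Strong continuity makes the
oscillation of `DX` small near `h(t)`, while `|v|/|u - t|` stays bounded. -/
theorem tendsto_eLpNorm_shiftRemainder (hμ : IsWienerMeasure T μ) {p q : ℝ≥0∞} (hq1 : 1 ≤ q)
    (hqp : q < p) (hp : p ≠ ∞) {X : PathSpace T → ℝ} {DX : PathSpace T → L2T T}
    {c : ℕ → L2T T →₀ ℝ} (hX : MemLp X p μ) (hDX : MemLp DX p μ)
    (hc : Tendsto (fun n => eLpNorm (fun ω => expComb hμ (c n) ω - X ω) p μ) atTop (𝓝 0))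
    (hcD : Tendsto (fun n => eLpNorm (fun ω => expCombDeriv hμ (c n) ω - DX ω) p μ) atTop (𝓝 0))
    {h : ℝ → L2T T} {h' : L2T T} {s : Set ℝ} {t : ℝ} (hh : HasDerivWithinAt h h' s t) :
    Tendsto (fun u => ‖(u - t)⁻¹‖ₑ * eLpNorm (shiftRemainder X DX (h t) (h u - h t)) q μ)
      (𝓝[s \ {t}] t) (𝓝 0) := by
  refine ENNReal.tendsto_nhds_zero.2 fun ε hε => ?_
  -- The mean value inequality will be used with `B = ε / b`, which has to be finite.
  wlog hεt : ε ≠ ∞ generalizing ε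
  · rw [not_not.1 hεt]
    exact Eventually.of_forall fun _ => le_top
  set b : ℝ≥0∞ := ‖h'‖ₑ + 1 with hb_def
  have hb0 : b ≠ 0 := by simp [hb_def]
  have hbt : b ≠ ∞ := ENNReal.add_ne_top.2 ⟨enorm_ne_top, ENNReal.one_ne_top⟩
  have h1 := ENNReal.tendsto_nhds_zero.1
    (hμ.tendsto_eLpNorm_comp_shift hq1 hqp hp hDX (h t)) (ε / b) (ENNReal.div_pos hε.ne' hbt)
  obtain ⟨η, hη, hball⟩ := Metric.eventually_nhds_iff_ball.1 h1
  have hcont : Tendsto h (𝓝[s \ {t}] t) (𝓝 (h t)) :=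
    hh.continuousWithinAt.mono Set.sdiff_subset
  have hslope : ∀ᶠ u in 𝓝[s \ {t}] t, ‖slope h t u‖ₑ < b :=
    ((continuous_enorm.tendsto h').comp (hasDerivWithinAt_iff_tendsto_slope.1 hh)).eventually
      (gt_mem_nhds (ENNReal.lt_add_right enorm_ne_top one_ne_zero))
  filter_upwards [hcont.eventually (Metric.ball_mem_nhds (h t) hη), hslope] with u hu hsl
  have h2 := hμ.eLpNorm_shiftRemainder_le hq1 hqp hp hX hDX hc hcD (h t) (h u - h t)
    (B := ε / b) (ENNReal.div_ne_top hεt hb0) fun r hr => hball _ (by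
      rw [mem_ball_iff_norm, add_sub_cancel_left, norm_smul, Real.norm_of_nonneg hr.1]
      exact (mul_le_of_le_one_left (norm_nonneg _) hr.2).trans_lt (mem_ball_iff_norm.1 hu))
  calc _ ≤ ‖(u - t)⁻¹‖ₑ * (ε / b * ‖h u - h t‖ₑ) := by gcongr
    _ = ε / b * ‖slope h t u‖ₑ := by
      rw [slope, vsub_eq_sub, enorm_smul]
      ring
    _ ≤ ε / b * b := by gcongr
    _ = ε := ENNReal.div_mul_cancel hb0 hbt

/-- If `X_t` is in the Malliavin-Sobolev space, then `u ↦ T_{h(u)} X_u` is differentiable at `t`. -/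
theorem hasLqDerivWithinAt_pathShift (hμ : IsWienerMeasure T μ) {p q : ℝ≥0∞} [Fact (1 ≤ p)]
    (hq1 : 1 ≤ q) (hqp : q < p) (hp : p ≠ ∞) {X : ℝ → Lp ℝ p μ} {X' : Lp ℝ p μ} {h : ℝ → L2T T}
    {h' : L2T T} {s : Set ℝ} {t : ℝ} (hX : HasDerivWithinAt X X' s t)
    (hh : HasDerivWithinAt h h' s t) {DX : PathSpace T → L2T T} {c : ℕ → L2T T →₀ ℝ}
    (hDX : MemLp DX p μ)
    (hc : Tendsto (fun n => eLpNorm (fun ω => expComb hμ (c n) ω - X t ω) p μ) atTop (𝓝 0))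
    (hcD : Tendsto (fun n => eLpNorm (fun ω => expCombDeriv hμ (c n) ω - DX ω) p μ) atTop (𝓝 0)) :
    HasLqDerivWithinAt μ q (fun u => pathShift (h u) (X u))
      (fun ω => pathShift (h t) X' ω + inner ℝ (DX (shift (h t) ω)) h') s t := by
  have hTD : MemLp (fun ω => DX (shift (h t) ω)) q μ := hμ.memLp_comp_shift hq1 hqp (h t) hDX
  have hTX' : MemLp (pathShift (h t) X') q μ := hμ.memLp_comp_shift hq1 hqp (h t) (Lp.memLp X')
  have mI (v : L2T T) : AEStronglyMeasurable (fun ω => inner ℝ (DX (shift (h t) ω)) v) μ :=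
    hTD.1.inner aestronglyMeasurable_const
  refine ⟨hTX'.add ⟨mI h', (eLpNorm_inner_le _ h' q).trans_lt
    (ENNReal.mul_lt_top enorm_lt_top hTD.2)⟩, ?_⟩
  set C := shiftBound p q (‖h t‖ + 1)
  set F : ℝ → PathSpace T → ℝ := fun u ω => (u - t)⁻¹ * (X u ω - X t ω) - X' ω
  have mF (u : ℝ) : AEStronglyMeasurable (F u) μ :=
    (((Lp.aestronglyMeasurable (X u)).sub (Lp.aestronglyMeasurable (X t))).const_mul
      (u - t)⁻¹).sub (Lp.aestronglyMeasurable X')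
  have mT (u : ℝ) {Y : PathSpace T → ℝ} (hY : AEStronglyMeasurable Y μ) :=
    hμ.aestronglyMeasurable_comp_shift (h u) hY
  have hcont : Tendsto h (𝓝[s \ {t}] t) (𝓝 (h t)) :=
    hh.continuousWithinAt.mono Set.sdiff_subset
  have hnear : ∀ᶠ u in 𝓝[s \ {t}] t, ‖h u‖ ≤ ‖h t‖ + 1 :=
    (hcont.norm.eventually (gt_mem_nhds (lt_add_one ‖h t‖))).mono fun _ h => h.le
  have h1 : Tendsto (fun u => C * eLpNorm (F u) p μ) (𝓝[s \ {t}] t) (𝓝 0) := by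
    simpa using ENNReal.Tendsto.const_mul (tendsto_eLpNorm_slope_sub hX)
      (Or.inr (shiftBound_ne_top p q (‖h t‖ + 1)))
  have h2 := (hμ.tendsto_eLpNorm_comp_shift hq1 hqp hp (Lp.memLp X') (h t)).comp hcont
  have h3 := hμ.tendsto_eLpNorm_shiftRemainder hq1 hqp hp (Lp.memLp (X t)) hDX hc hcD hh
  have h4 : Tendsto (fun u => ‖slope h t u - h'‖ₑ * eLpNorm (fun ω => DX (shift (h t) ω)) q μ)
      (𝓝[s \ {t}] t) (𝓝 0) := by
    have h5 := tendsto_iff_edist_tendsto_0.1 (hasDerivWithinAt_iff_tendsto_slope.1 hh)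
    simp only [edist_eq_enorm_sub] at h5
    simpa using ENNReal.Tendsto.mul_const h5 (Or.inr hTD.2.ne)
  have hsum := ((h1.add h2).add h3).add h4
  simp only [add_zero] at hsum
  refine tendsto_of_tendsto_of_tendsto_of_le_of_le' tendsto_const_nhds hsum
    (Eventually.of_forall fun _ => zero_le) ?_
  filter_upwards [hnear] with u hu
  -- Four errors: the translated slope error of `X`, the effect of moving the translation on `X'`,
  -- the first order remainder for `X_t`, and the slope error of `h` paired with the translated
  -- `DX`. They match `h1` to `h4`.
  have hsplit : (fun ω => (u - t)⁻¹ * (pathShift (h u) (X u) ω - pathShift (h t) (X t) ω)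
        - (pathShift (h t) X' ω + inner ℝ (DX (shift (h t) ω)) h'))
      = (fun ω => F u (shift (h u) ω)) + (fun ω => X' (shift (h u) ω) - X' (shift (h t) ω))
        + ((u - t)⁻¹ • shiftRemainder (X t) DX (h t) (h u - h t))
        + fun ω => inner ℝ (DX (shift (h t) ω)) (slope h t u - h') := by
    ext1 ω
    simp only [Pi.add_apply, Pi.smul_apply, smul_eq_mul, shiftRemainder, F, slope, vsub_eq_sub,
      inner_sub_right, inner_smul_right, add_sub_cancel]
    change (u - t)⁻¹ * (X u (shift (h u) ω) - X t (shift (h t) ω))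
        - (X' (shift (h t) ω) + inner ℝ (DX (shift (h t) ω)) h') = _
    ring
  have m1 := mT u (mF u)
  have m2 : AEStronglyMeasurable (fun ω => X' (shift (h u) ω) - X' (shift (h t) ω)) μ :=
    (mT u (Lp.aestronglyMeasurable X')).sub (mT t (Lp.aestronglyMeasurable X'))
  have m3 : AEStronglyMeasurable
      ((u - t)⁻¹ • shiftRemainder (X t) DX (h t) (h u - h t)) μ := by
    refine AEStronglyMeasurable.const_smul ?_ _
    exact ((hμ.aestronglyMeasurable_comp_shift _ (Lp.aestronglyMeasurable (X t))).sub
      (mT t (Lp.aestronglyMeasurable (X t)))).sub (mI _)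
  rw [hsplit]
  refine (eLpNorm_add_le ((m1.add m2).add m3) (mI _) hq1).trans (add_le_add ?_
    (eLpNorm_inner_le _ _ q))
  refine (eLpNorm_add_le (m1.add m2) m3 hq1).trans (add_le_add ?_ (eLpNorm_const_smul _ _ _ _).le)
  exact (eLpNorm_add_le m1 m2 hq1).trans (add_le_add
    (hμ.eLpNorm_comp_shift_le hq1 hqp hu (mF u)) le_rfl)

end IsWienerMeasure

/-! ### The derivative in `L²([0,T])` and the pointwise derivative -/

/-- The `L²` convergence of slopes gives almost everywhere convergence along some sequence tending
to `t`. Along a sequence, `h` and `H` agree off a single null set, so the limit is the pointwise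
derivative. -/
theorem ae_eq_derivWithin_of_hasDerivWithinAt {h : ℝ → L2T T} {h' : L2T T} {s : Set ℝ} {t : ℝ}
    (hs : UniqueDiffWithinAt ℝ s t) (ht : t ∈ s) (hh : HasDerivWithinAt h h' s t)
    {H : ℝ → ℝ → ℝ}
    (hH : ∀ᵐ x ∂(volume.restrict (Set.Icc 0 T)), DifferentiableWithinAt ℝ (fun r => H r x) s t)
    (hhH : ∀ r ∈ s, ∀ᵐ x ∂(volume.restrict (Set.Icc 0 T)), h r x = H r x) :
    ∀ᵐ x ∂(volume.restrict (Set.Icc 0 T)), h' x = derivWithin (fun r => H r x) s t := by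
  have hne : (𝓝[s \ {t}] t).NeBot := by
    rw [← accPt_principal_iff_nhdsWithin]
    exact hs.accPt
  obtain ⟨ns, hns, hae⟩ := (tendstoInMeasure_of_tendsto_Lp
    (hasDerivWithinAt_iff_tendsto_slope.1 hh)).exists_seq_tendsto_ae'
  obtain ⟨N, hN⟩ := eventually_atTop.1 (hns.eventually self_mem_nhdsWithin)
  have h1 : ∀ᵐ x ∂(volume.restrict (Set.Icc 0 T)), ∀ n, N ≤ n → h (ns n) x = H (ns n) x := by
    refine ae_all_iff.2 fun n => ?_
    by_cases hn : N ≤ n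
    · filter_upwards [hhH _ (hN n hn).1] with x hx _ using hx
    · exact ae_of_all _ fun _ h => absurd h hn
  have h2 : ∀ᵐ x ∂(volume.restrict (Set.Icc 0 T)), ∀ n,
      slope h t (ns n) x = (ns n - t)⁻¹ * (h (ns n) x - h t x) := by
    refine ae_all_iff.2 fun n => ?_
    filter_upwards [Lp.coeFn_smul (ns n - t)⁻¹ (h (ns n) - h t), Lp.coeFn_sub (h (ns n)) (h t)]
      with x h3 h4
    rw [slope, vsub_eq_sub, h3, Pi.smul_apply, h4, Pi.sub_apply, smul_eq_mul]
  filter_upwards [hae, h1, h2, hH, hhH t ht] with x h3 h4 h5 h6 h7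
  refine tendsto_nhds_unique h3 ?_
  refine ((hasDerivWithinAt_iff_tendsto_slope.1 h6.hasDerivWithinAt).comp hns).congr' ?_
  filter_upwards [eventually_ge_atTop N] with n hn
  rw [h5 n, h4 n hn, h7, Function.comp_apply, slope_def_field, div_eq_inv_mul]

end

theorem mainTheorem9 {T : ℝ} (hT : 0 < T) {μ : Measure (PathSpace T)} (hμ : IsWienerMeasure T μ)
    {p : ℝ≥0∞} [Fact (1 ≤ p)] (hp1 : 1 < p) (hp : p ≠ ∞)
    (X X' : ℝ → Lp ℝ p μ)
    (hX : ∀ t ∈ Set.Icc 0 T, HasDerivWithinAt X (X' t) (Set.Icc 0 T) t)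
    (h h' : ℝ → L2T T)
    (hh : ∀ t ∈ Set.Icc 0 T, HasDerivWithinAt h (h' t) (Set.Icc 0 T) t) :
    -- If `h` is given by a function `H(t,s)` that is `C¹` in `t` for almost all `s`, then `h'` is
    -- the pointwise partial derivative of `H` with respect to `t`.
    (∀ H : ℝ → ℝ → ℝ,
      (∀ᵐ s ∂(volume.restrict (Set.Icc 0 T)), ContDiffOn ℝ 1 (fun t => H t s) (Set.Icc 0 T)) →
      (∀ t ∈ Set.Icc 0 T, ∀ᵐ s ∂(volume.restrict (Set.Icc 0 T)), h t s = H t s) →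
      ∀ t ∈ Set.Icc 0 T, ∀ᵐ s ∂(volume.restrict (Set.Icc 0 T)),
        h' t s = derivWithin (fun r => H r s) (Set.Icc 0 T) t) ∧
    ∀ t ∈ Set.Icc 0 T,
      -- All random variables in the formula, except possibly the Wick product, are in `𝓛^q`, `q < p`.
      (∀ q < p, MemLp (pathShift (h t) (X t)) q μ ∧ MemLp (pathShift (h t) (X' t)) q μ ∧
        MemLp (fun ω => pathShift (h t) (X t) ω * wienerIntegral hμ (h' t) ω) q μ) ∧
      -- The formula holds for the generalized random variables (functionals on the span of the
      -- stochastic exponentials), where derivatives are weak and the Wick product always exists.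
      (∀ f : L2T T, HasDerivWithinAt (fun u => sTransform hμ (pathShift (h u) (X u)) f)
        (sTransform hμ (pathShift (h t) (X' t)) f
          + sTransform hμ (fun ω => pathShift (h t) (X t) ω * wienerIntegral hμ (h' t) ω) f
          - sTransform hμ (pathShift (h t) (X t)) f * sTransform hμ (wienerIntegral hμ (h' t)) f)
        (Set.Icc 0 T) t) ∧
      -- If the derivative exists in `𝓛^q` for some `q > 1`, then so does the Wick product, and the
      -- formula is an almost sure identity of random variables.
      (∀ q : ℝ≥0∞, 1 < q → ∀ A : PathSpace T → ℝ,
        HasLqDerivWithinAt μ q (fun u => pathShift (h u) (X u)) A (Set.Icc 0 T) t →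
        ∃ Z, IsWickProduct hμ (pathShift (h t) (X t)) (wienerIntegral hμ (h' t)) Z ∧
          ∀ᵐ ω ∂μ, A ω = pathShift (h t) (X' t) ω
            + pathShift (h t) (X t) ω * wienerIntegral hμ (h' t) ω - Z ω) ∧
      -- If `X_t ∈ 𝔻^{1,p}`, then the Wick product exists and the derivative exists in the norm of
      -- `𝓛^q` for all `1 ≤ q < p`.
      (MemD1 hμ p (X t) →
        ∃ Z, IsWickProduct hμ (pathShift (h t) (X t)) (wienerIntegral hμ (h' t)) Z ∧
          ∀ q : ℝ≥0∞, 1 ≤ q → q < p → MemLp Z q μ ∧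
            HasLqDerivWithinAt μ q (fun u => pathShift (h u) (X u))
              (fun ω => pathShift (h t) (X' t) ω
                + pathShift (h t) (X t) ω * wienerIntegral hμ (h' t) ω - Z ω)
              (Set.Icc 0 T) t) := by
  have hsd (t : ℝ) (ht : t ∈ Set.Icc 0 T) : UniqueDiffWithinAt ℝ (Set.Icc 0 T) t :=
    uniqueDiffOn_Icc hT t ht
  refine ⟨fun H hH hhH t ht => ?_, fun t ht => ⟨fun q hq => ⟨?_, ?_, ?_⟩, fun f => ?_,
    fun q hq A hA => ?_, ?_⟩⟩
  · refine ae_eq_derivWithin_of_hasDerivWithinAt (hsd t ht) ht (hh t ht) ?_ hhH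
    filter_upwards [hH] with x hx
    exact hx.differentiableOn one_ne_zero t ht
  · exact hμ.memLp_pathShift hp1 hq (h t) (Lp.memLp (X t))
  · exact hμ.memLp_pathShift hp1 hq (h t) (Lp.memLp (X' t))
  · exact hμ.memLp_pathShift_mul_wienerIntegral hp1 hq (h t) (h' t) (Lp.memLp (X t))
  · exact hμ.hasDerivWithinAt_sTransform hp1 (hX t ht) (hh t ht) f
  -- `Z` is defined by solving the formula for its last term; the content lies in its being the Wick
  -- product.
  · exact ⟨_, hμ.isWickProduct_of_hasLqDerivWithinAt hp1 (hX t ht) (hh t ht) (hsd t ht) hq hA,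
      ae_of_all _ fun ω => by ring⟩
  · rintro ⟨-, DX, c, hDX, hc, hcD⟩
    -- The derivative `T_h X' + ⟨T_h DX, h'⟩` does not depend on `q`, so the `Z` obtained from one
    -- exponent `r > 1` serves all `q < p`, including `q = 1`.
    have hA {q : ℝ≥0∞} (hq1 : 1 ≤ q) (hqp : q < p) :=
      hμ.hasLqDerivWithinAt_pathShift hq1 hqp hp (hX t ht) (hh t ht) hDX hc hcD
    obtain ⟨r, hr1, hrp⟩ := exists_between hp1
    refine ⟨_, hμ.isWickProduct_of_hasLqDerivWithinAt hp1 (hX t ht) (hh t ht) (hsd t ht) hr1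
      (hA hr1.le hrp), fun q hq1 hqp => ⟨?_, ?_⟩⟩
    · exact ((hμ.memLp_pathShift hp1 hqp (h t) (Lp.memLp (X' t))).add
        (hμ.memLp_pathShift_mul_wienerIntegral hp1 hqp (h t) (h' t) (Lp.memLp (X t)))).sub
        (hA hq1 hqp).1
    · convert hA hq1 hqp using 2 with ω
      ring
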